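/- Let $K=\mathbb F_q$ be a finite field with $q$ elements and $R=K[x_1,x_2,y_1,y_2]$. Let $(A,B)\in GL_2(K)\times GL_2(K)$ act on $R$ by the $K$-algebra automorphism that sends the column vector $(x_1,x_2)^t$ to $(A^t)^{-1}(x_1,x_2)^t$ and $(y_1,y_2)^t$ to $B(y_1,y_2)^t$. Let $R^{GL_2\times GL_2}$ be the ring of invariants of all such pairs, and let $R^{GL_2}\supseteq R^{GL_2\times GL_2}$ be the ring of invariants of the diagonal pairs $(A,A)$, $A\in GL_2(K)$. Put $$d=x_1^{q}x_2-x_1x_2^{q},\quad d^*=y_1y_2^{q}-y_1^{q}y_2,\quad u_0=x_1y_1+x_2y_2,\quad u_1=x_1^{q}y_1+x_2^{q}y_2,\quad u_1^*=x_1y_1^{q}+x_2y_2^{q}.$$ Then for $0\le s\le q-1$ the polynomial $u_1^{s+1}(d^*)^{q-s-1}+(u_1^*)^{q-s}d^{s}$ is divisible by $u_0^{q}$ in $R$; let $h_s\in R$ be the quotient. Let $D$ be the set of the polynomials - $(u_1^*)^{i}u_1^{j}(d^*d)^{\alpha}$ with $0\le i,j\le q-1$ and $0\le\alpha\le q-2$;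 - $(u_1^*)^{i}u_1^{j}u_0^{k}(d^*d)^{\alpha}$ with $0\le i,j\le q-2$, $1\le k\le q$ and $0\le\alpha\le q-2$; - $h_su_0^{k}(d^*)^{\gamma}d^{\beta}$ with $1\le s\le q-2$, $0\le k\le q-1$, $0\le\beta\le q-2$, where $\gamma\in\{0,\dots,q-2\}$ is determined by $\gamma\equiv\beta+s \pmod{q-1}$. Then $D$ has exactly $(q^2-1)(q^2-q)$ elements, and $R^{GL_2}$ is a free $R^{GL_2\times GL_2}$-module with basis $D$. -/

import Mathlib

open MvPolynomial

noncomputable section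

namespace VectorCovector

variable (K : Type*) [Field K]

/-- The polynomial ring `R₂ = F_q[x₁, x₂, y₁, y₂]`; the left copy of `Fin 2` indexes the `x`'s
and the right copy the `y`'s. -/
abbrev R : Type _ := MvPolynomial (Fin 2 ⊕ Fin 2) K

/-- The variables `x₁ = x 0`, `x₂ = x 1`. -/
def x (i : Fin 2) : R K := X (Sum.inl i)

/-- The variables `y₁ = y 0`, `y₂ = y 1`. -/
def y (i : Fin 2) : R K := X (Sum.inr i)

variable {K} in
/-- The substitution attached to `(A, B) ∈ GL₂ × GL₂`: the column vector of the `x`'s is multiplied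
by `(Aᵗ)⁻¹`, the column vector of the `y`'s by `B`. -/
def act (A B : GL (Fin 2) K) : R K →ₐ[K] R K :=
  aeval (Sum.elim
    (fun i => ∑ j, C (((A⁻¹ : GL (Fin 2) K) : Matrix (Fin 2) (Fin 2) K).transpose i j) * x K j)
    (fun i => ∑ j, C ((B : Matrix (Fin 2) (Fin 2) K) i j) * y K j))

/-- The invariant ring of `GL₂`, embedded diagonally in `GL₂ × GL₂`. -/
def invGL : Subalgebra K (R K) :=
  ⨅ A : GL (Fin 2) K, AlgHom.equalizer (act A A) (AlgHom.id K (R K))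

/-- The invariant ring of `GL₂ × GL₂`. -/
def invGLGL : Subalgebra K (R K) :=
  ⨅ A : GL (Fin 2) K, ⨅ B : GL (Fin 2) K, AlgHom.equalizer (act A B) (AlgHom.id K (R K))

theorem mem_invGL (f : R K) : f ∈ invGL K ↔ ∀ A : GL (Fin 2) K, act A A f = f := by
  simp [invGL, Algebra.mem_iInf, AlgHom.mem_equalizer]

theorem mem_invGLGL (f : R K) :
    f ∈ invGLGL K ↔ ∀ A B : GL (Fin 2) K, act A B f = f := by
  simp [invGLGL, Algebra.mem_iInf, AlgHom.mem_equalizer]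

theorem invGLGL_le_invGL : invGLGL K ≤ invGL K := by
  intro f hf
  rw [mem_invGLGL] at hf
  exact (mem_invGL K f).2 fun A => hf A A

/-- `R₂^{GL₂}` is an algebra, hence a module, over its subring `R₂^{GL₂ × GL₂}`. -/
instance : Algebra (invGLGL K) (invGL K) :=
  (Subalgebra.inclusion (invGLGL_le_invGL K)).toRingHom.toAlgebra

theorem coe_smul_invGL (a : invGLGL K) (f : invGL K) :
    ((a • f : invGL K) : R K) = (a : R K) * (f : R K) := rfl

variable [Fintype K]

/-- The order `q` of the ground field. -/
abbrev q : ℕ := Fintype.card K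

/-- `d_{2,2}`. -/
def d : R K := Matrix.det !![x K 1, x K 1 ^ q K; x K 0, x K 0 ^ q K]

/-- `d*_{2,2}`. -/
def dStar : R K := Matrix.det !![y K 0, y K 0 ^ q K; y K 1, y K 1 ^ q K]

/-- `u₀ = x₁ y₁ + x₂ y₂`. -/
def u₀ : R K := x K 0 * y K 0 + x K 1 * y K 1

/-- `u₁ = x₁^q y₁ + x₂^q y₂`. -/
def u₁ : R K := x K 0 ^ q K * y K 0 + x K 1 ^ q K * y K 1

/-- `u₁* = x₁ y₁^q + x₂ y₂^q`. -/
def u₁Star : R K := x K 0 * y K 0 ^ q K + x K 1 * y K 1 ^ q K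

/-- The numerator `u₁^{s+1} (d*)^{q-s-1} + (u₁*)^{q-s} d^s` of `h_s`, for `0 ≤ s ≤ q - 1`. -/
def hNum (s : ℕ) : R K :=
  u₁ K ^ (s + 1) * dStar K ^ (q K - s - 1) + u₁Star K ^ (q K - s) * d K ^ s

open Classical in
/-- The polynomial `h_s`, the quotient of `hNum s` by `u₀ ^ q` (and `0` should the division not be
possible in the polynomial ring). -/
def h (s : ℕ) : R K :=
  if hs : u₀ K ^ q K ∣ hNum K s then hs.choose else 0

/-- The explicit set of module generators. The exponent `(β + s) % (q - 1)` of `d*` is the residue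
in `{0, …, q - 2}`. -/
def D : Set (R K) :=
  {f | ∃ i j α : ℕ, i ≤ q K - 1 ∧ j ≤ q K - 1 ∧ α ≤ q K - 2 ∧
      f = u₁Star K ^ i * u₁ K ^ j * (dStar K * d K) ^ α} ∪
  {f | ∃ i j k α : ℕ, i ≤ q K - 2 ∧ j ≤ q K - 2 ∧ 1 ≤ k ∧ k ≤ q K ∧ α ≤ q K - 2 ∧
      f = u₁Star K ^ i * u₁ K ^ j * u₀ K ^ k * (dStar K * d K) ^ α} ∪
  {f | ∃ s k β : ℕ, 1 ≤ s ∧ s ≤ q K - 2 ∧ k ≤ q K - 1 ∧ β ≤ q K - 2 ∧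
      f = h K s * u₀ K ^ k * dStar K ^ ((β + s) % (q K - 1)) * d K ^ β}

end VectorCovector

end

/-!
The proof treats `SL₂` first and needs neither Dickson's theorem nor any field theory. Let `P` be the
ring of invariants of `SL₂ × SL₂`, and let the *generators* be the elements of `D` stripped of their
factors `d` and `d*`. The invariants of the diagonal `SL₂` turn out to be free over `P` on the
generators.

*Spanning after inversion of `d`.* The matrix that expresses `u₀, u₁` by `y₁, y₂` has determinant
`d`, up to sign. So every `f` becomes, after multiplication by a power of `d`, a polynomial in `u₀`
and `u₁` with coefficients free of `y`; if `f` is invariant, then the coefficients are, hence they lie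
in `P` (`exists_d_pow_mul_mem_genSpan`). The `P`-span of the generators contains all these
polynomials, because it is stable under multiplication by `u₀` and `u₁` (`u₀_mul_mem_genSpan`,
`u₁_mul_mem_genSpan`). This rests on explicit relations: the Cauchy–Binet formula `d_mul_dStar`, the
recursions `u₁_mul_h` and `u₁Star_mul_h` and the formulas for `u₁ ^ q` and `u₁* ^ q`, in which
`h₀` and `h_{q-1}` are invariants of `SL₂ × SL₂`.

*Removing the denominators.* It remains that the generators are independent over `P` modulo `d`. An
element of `P` divisible by `x₁` is divisible by all linear forms in the `x`'s, hence by `d`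
(`d_dvd`). So it suffices to restrict to the line `x₁ = 0` (`restr_eq_zero_of_sum`). There the
generators are monomials in `x₂` and `y₂`, up to invariants, and the elements of `P` involve only
powers of `x₂ ^ (q (q - 1))`. A relation thus splits by the exponent of `x₂` into relations
`∑ b_F y₂ ^ F = 0` with coefficients invariant under `SL₂`. All nonzero linear forms in the `y`'s
are then roots of `∑ b_F T ^ F`, which makes it a multiple of a Dickson polynomial of degree `q² - 1`.
It vanishes since the exponents that occur are distinct modulo `q² - 1` (`eq_zero_of_eval_forms`,
`eq_of_exp_modEq`). The same argument, with divisibility by all powers of `d`, gives independence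
over `P` itself (`eq_zero_of_sum_gen`).

*From `SL₂` to `GL₂`.* The quotient `GL₂ / SL₂` is cyclic of order `q - 1`, prime to the
characteristic. So `P` is the sum of its weight spaces for the two determinants, and a semi-invariant
of weight `(b, c)` is `d ^ b d* ^ c` times an invariant of `GL₂ × GL₂` (`exists_isotypic_eq`).
Averaging over the diagonal determinant selects from the products of generators with powers of `d`
and `d*` exactly the set `D` (`mem_span_basisElem`), and the independence of characters gives the
independence of `D` (`eq_zero_of_sum_basisElem`).
-/

namespace VectorCovector

/-! ### Linear substitutions of the two pairs of variables -/

noncomputable section Substitutions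

variable {K : Type*} [Field K]

/-- The substitution that multiplies the column vector of the `x`'s by `G` and that of the `y`'s
by `H`, for arbitrary matrices. The assignment `(G, H) ↦ sub G H` reverses products. -/
def sub (G H : Matrix (Fin 2) (Fin 2) K) : R K →ₐ[K] R K :=
  aeval (Sum.elim (fun i => ∑ j, C (G i j) * x K j) (fun i => ∑ j, C (H i j) * y K j))

theorem act_eq_sub (A B : GL (Fin 2) K) :
    act A B = sub ((A⁻¹ : GL (Fin 2) K) : Matrix (Fin 2) (Fin 2) K).transpose
      (B : Matrix (Fin 2) (Fin 2) K) := rfl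

theorem sub_x (G H : Matrix (Fin 2) (Fin 2) K) (i : Fin 2) :
    sub G H (x K i) = C (G i 0) * x K 0 + C (G i 1) * x K 1 := by
  conv_lhs => rw [x, sub, aeval_X]
  simp [Fin.sum_univ_two]

theorem sub_y (G H : Matrix (Fin 2) (Fin 2) K) (i : Fin 2) :
    sub G H (y K i) = C (H i 0) * y K 0 + C (H i 1) * y K 1 := by
  conv_lhs => rw [y, sub, aeval_X]
  simp [Fin.sum_univ_two]

theorem sub_C (G H : Matrix (Fin 2) (Fin 2) K) (a : K) : sub G H (C a) = C a :=
  (sub G H).commutes a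

theorem algHom_ext_xy {S : Type*} [Semiring S] [Algebra K S] {f g : R K →ₐ[K] S}
    (hx : ∀ i, f (x K i) = g (x K i)) (hy : ∀ i, f (y K i) = g (y K i)) : f = g := by
  apply MvPolynomial.algHom_ext
  rintro (i | i)
  · exact hx i
  · exact hy i

theorem sub_sub (G H G' H' : Matrix (Fin 2) (Fin 2) K) (p : R K) :
    sub G H (sub G' H' p) = sub (G' * G) (H' * H) p := by
  have : (sub G H).comp (sub G' H') = sub (G' * G) (H' * H) := by
    apply algHom_ext_xy <;> intro i <;>
      simp only [AlgHom.comp_apply, sub_x, sub_y, map_add, map_mul, sub_C, Matrix.mul_apply,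
        Fin.sum_univ_two] <;> ring
  exact DFunLike.congr_fun this p

theorem sub_one (p : R K) : sub 1 1 p = p := by
  have : sub (1 : Matrix (Fin 2) (Fin 2) K) 1 = AlgHom.id K (R K) := by
    apply algHom_ext_xy <;> intro i <;> fin_cases i <;> simp [sub_x, sub_y]
  exact DFunLike.congr_fun this p

variable (K) in
/-- The exchange of the `x`'s and the `y`'s. -/
def swap : R K →ₐ[K] R K := rename Sum.swap

@[simp] theorem swap_x (i : Fin 2) : swap K (x K i) = y K i := by
  simp [swap, x, y]

@[simp] theorem swap_y (i : Fin 2) : swap K (y K i) = x K i := by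
  simp [swap, x, y]

theorem swap_swap (p : R K) : swap K (swap K p) = p := by
  have : (swap K).comp (swap K) = AlgHom.id K (R K) := by
    apply algHom_ext_xy <;> intro i <;> simp
  exact DFunLike.congr_fun this p

theorem swap_C (a : K) : swap K (C a) = C a := (swap K).commutes a

theorem swap_sub (G H : Matrix (Fin 2) (Fin 2) K) (p : R K) :
    swap K (sub G H p) = sub H G (swap K p) := by
  have : (swap K).comp (sub G H) = (sub H G).comp (swap K) := by
    apply algHom_ext_xy <;> intro i <;> simp [sub_x, sub_y]
  exact DFunLike.congr_fun this p

variable (K) in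
/-- The invariants of `SL₂ × SL₂`. -/
def invSLSL : Subalgebra K (R K) where
  carrier := {p | ∀ G H : Matrix (Fin 2) (Fin 2) K, G.det = 1 → H.det = 1 → sub G H p = p}
  mul_mem' ha hb G H hG hH := by rw [map_mul, ha G H hG hH, hb G H hG hH]
  add_mem' ha hb G H hG hH := by rw [map_add, ha G H hG hH, hb G H hG hH]
  algebraMap_mem' r G H _ _ := (sub G H).commutes r

theorem swap_mem_invSLSL {p : R K} (hp : p ∈ invSLSL K) : swap K p ∈ invSLSL K := by
  intro G H hG hH
  rw [← swap_sub, hp H G hH hG]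

/-- Semi-invariants of `GL₂ × GL₂` of weight `(b, c)`. -/
def IsSemi (b c : ℕ) (p : R K) : Prop :=
  ∀ G H : Matrix (Fin 2) (Fin 2) K, G.det ≠ 0 → H.det ≠ 0 →
    sub G H p = C (G.det ^ b * H.det ^ c) * p

theorem IsSemi.mem_invSLSL {b c : ℕ} {p : R K} (hp : IsSemi b c p) : p ∈ invSLSL K := by
  intro G H hG hH
  rw [hp G H (by simp [hG]) (by simp [hH]), hG, hH]
  simp

theorem IsSemi.swap {b c : ℕ} {p : R K} (hp : IsSemi b c p) : IsSemi c b (swap K p) := by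
  intro G H hG hH
  rw [← swap_sub, hp H G hH hG, map_mul, swap_C, mul_comm (H.det ^ b)]

theorem mem_invGLGL_iff_isSemi {p : R K} : p ∈ invGLGL K ↔ IsSemi 0 0 p := by
  rw [mem_invGLGL]
  constructor
  · intro h G H hG hH
    have := h (Matrix.GeneralLinearGroup.mkOfDetNeZero G.transpose (by simpa using hG))⁻¹
      (Matrix.GeneralLinearGroup.mkOfDetNeZero H hH)
    rw [act_eq_sub, inv_inv] at this
    simpa [Matrix.GeneralLinearGroup.mkOfDetNeZero, Matrix.transpose_transpose] using this
  · intro h A B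
    have hA : (((A⁻¹ : GL (Fin 2) K) : Matrix (Fin 2) (Fin 2) K).transpose).det ≠ 0 := by
      rw [Matrix.det_transpose]
      exact Matrix.GeneralLinearGroup.det_ne_zero _
    have := h _ _ hA (Matrix.GeneralLinearGroup.det_ne_zero B)
    rw [act_eq_sub, this]
    simp

theorem mem_invGL_iff_sub {p : R K} : p ∈ invGL K ↔
    ∀ G H : Matrix (Fin 2) (Fin 2) K, H * G.transpose = 1 → sub G H p = p := by
  rw [mem_invGL]
  constructor
  · intro h G H hGH
    have h1 : G.transpose * H = 1 := mul_eq_one_comm.1 hGH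
    have := h ⟨H, G.transpose, hGH, h1⟩
    rwa [act_eq_sub, Units.inv_mk, Matrix.transpose_transpose] at this
  · intro h A
    rw [act_eq_sub]
    apply h
    rw [Matrix.transpose_transpose]
    exact A.mul_inv

end Substitutions

/-! ### Weights of the basic polynomials -/

noncomputable section Frobenius

variable {K : Type*} [Field K] [Fintype K]

theorem two_le_q : 2 ≤ q K := Fintype.one_lt_card

theorem add_pow_q (a b : R K) : (a + b) ^ q K = a ^ q K + b ^ q K :=
  map_add (FiniteField.frobeniusAlgHom K (R K)) a b

theorem sub_pow_q (a b : R K) : (a - b) ^ q K = a ^ q K - b ^ q K :=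
  map_sub (FiniteField.frobeniusAlgHom K (R K)) a b

theorem C_pow_q (a : K) : (C a : R K) ^ q K = C a := by
  rw [← C_pow, FiniteField.pow_card]

theorem C_mul_pow_q (a : K) (f : R K) : (C a * f) ^ q K = C a * f ^ q K := by
  rw [mul_pow, C_pow_q]

theorem d_eq : d K = x K 0 ^ q K * x K 1 - x K 0 * x K 1 ^ q K := by
  rw [d, Matrix.det_fin_two_of]; ring

theorem dStar_eq : dStar K = y K 0 * y K 1 ^ q K - y K 0 ^ q K * y K 1 := by
  rw [dStar, Matrix.det_fin_two_of]

theorem swap_d : swap K (d K) = - dStar K := by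
  simp only [d_eq, dStar_eq, map_sub, map_mul, map_pow, swap_x]; ring

theorem swap_dStar : swap K (dStar K) = - d K := by
  simp only [d_eq, dStar_eq, map_sub, map_mul, map_pow, swap_y]; ring

theorem swap_u₀ {K : Type*} [Field K] : swap K (u₀ K) = u₀ K := by
  simp only [u₀, map_add, map_mul, swap_x, swap_y]; ring

theorem swap_u₁ : swap K (u₁ K) = u₁Star K := by
  simp only [u₁, u₁Star, map_add, map_mul, map_pow, swap_x, swap_y]; ring

theorem swap_u₁Star : swap K (u₁Star K) = u₁ K := by
  simp only [u₁, u₁Star, map_add, map_mul, map_pow, swap_x, swap_y]; ring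

theorem isSemi_d : IsSemi 1 0 (d K) := by
  intro G H _ _
  simp only [d_eq, map_sub, map_mul, map_pow, sub_x, add_pow_q, C_mul_pow_q, Matrix.det_fin_two]
  simp
  ring

theorem isSemi_dStar : IsSemi 0 1 (dStar K) := by
  have := (isSemi_d (K := K)).swap
  rw [swap_d] at this
  intro G H hG hH
  have := this G H hG hH
  simpa using this

theorem d_mem : d K ∈ invSLSL K := isSemi_d.mem_invSLSL
theorem dStar_mem : dStar K ∈ invSLSL K := isSemi_dStar.mem_invSLSL

theorem entries_of_mul_transpose {K : Type*} [Field K] {G H : Matrix (Fin 2) (Fin 2) K}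
    (hGH : H * G.transpose = 1) :
    (C (G 0 0) * C (H 0 0) + C (G 1 0) * C (H 1 0) = (1 : R K)) ∧
    (C (G 0 0) * C (H 0 1) + C (G 1 0) * C (H 1 1) = (0 : R K)) ∧
    (C (G 0 1) * C (H 0 0) + C (G 1 1) * C (H 1 0) = (0 : R K)) ∧
    (C (G 0 1) * C (H 0 1) + C (G 1 1) * C (H 1 1) = (1 : R K)) := by
  have h := mul_eq_one_comm.1 hGH
  refine ⟨?_, ?_, ?_, ?_⟩
  · have := congrFun (congrFun h 0) 0
    simp [Matrix.mul_apply, Fin.sum_univ_two] at this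
    simp only [← C_mul, ← C_add, this, C_1]
  · have := congrFun (congrFun h 0) 1
    simp [Matrix.mul_apply, Fin.sum_univ_two] at this
    simp only [← C_mul, ← C_add, this, C_0]
  · have := congrFun (congrFun h 1) 0
    simp [Matrix.mul_apply, Fin.sum_univ_two] at this
    simp only [← C_mul, ← C_add, this, C_0]
  · have := congrFun (congrFun h 1) 1
    simp [Matrix.mul_apply, Fin.sum_univ_two] at this
    simp only [← C_mul, ← C_add, this, C_1]

theorem sub_u₀ {K : Type*} [Field K] {G H : Matrix (Fin 2) (Fin 2) K} (hGH : H * G.transpose = 1) :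
    sub G H (u₀ K) = u₀ K := by
  obtain ⟨h1, h2, h3, h4⟩ := entries_of_mul_transpose hGH
  simp only [u₀, map_add, map_mul, sub_x, sub_y]
  linear_combination x K 0 * y K 0 * h1 + x K 0 * y K 1 * h2 + x K 1 * y K 0 * h3 +
    x K 1 * y K 1 * h4

theorem sub_u₁ {G H : Matrix (Fin 2) (Fin 2) K} (hGH : H * G.transpose = 1) :
    sub G H (u₁ K) = u₁ K := by
  obtain ⟨h1, h2, h3, h4⟩ := entries_of_mul_transpose hGH
  simp only [u₁, map_add, map_mul, map_pow, sub_x, sub_y, add_pow_q, C_mul_pow_q]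
  linear_combination x K 0 ^ q K * y K 0 * h1 + x K 0 ^ q K * y K 1 * h2 +
    x K 1 ^ q K * y K 0 * h3 + x K 1 ^ q K * y K 1 * h4

theorem sub_u₁Star {G H : Matrix (Fin 2) (Fin 2) K} (hGH : H * G.transpose = 1) :
    sub G H (u₁Star K) = u₁Star K := by
  obtain ⟨h1, h2, h3, h4⟩ := entries_of_mul_transpose hGH
  simp only [u₁Star, map_add, map_mul, map_pow, sub_x, sub_y, add_pow_q, C_mul_pow_q]
  linear_combination x K 0 * y K 0 ^ q K * h1 + x K 0 * y K 1 ^ q K * h2 +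
    x K 1 * y K 0 ^ q K * h3 + x K 1 * y K 1 ^ q K * h4

/-- The homogeneous form of `∏ (T - a) = T ^ q - T`. -/
theorem prod_X_sub_C_smul {A : Type*} [CommRing A] [IsDomain A] [Algebra K A] {α : A}
    (hα : α ≠ 0) :
    ∏ a : K, (Polynomial.X - Polynomial.C (a • α)) =
      Polynomial.X ^ q K - Polynomial.C (α ^ (q K - 1)) * Polynomial.X := by
  classical
  have hq := two_le_q (K := K)
  have hinj : Function.Injective fun a : K => a • α := smul_left_injective K hα
  have hlow : (Polynomial.C (α ^ (q K - 1)) * Polynomial.X : Polynomial A).degree < ((q K : ℕ) : WithBot ℕ) := by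
    refine (Polynomial.degree_C_mul_X_le _).trans_lt ?_
    exact_mod_cast hq
  have hmon : (Polynomial.X ^ q K - Polynomial.C (α ^ (q K - 1)) * Polynomial.X).Monic :=
    Polynomial.monic_X_pow_sub hlow
  have hdeg : (Polynomial.X ^ q K - Polynomial.C (α ^ (q K - 1)) * Polynomial.X).degree =
      ((q K : ℕ) : WithBot ℕ) := by
    rw [Polynomial.degree_sub_eq_left_of_degree_lt] <;> rw [Polynomial.degree_X_pow]
    exact hlow
  have hprod : (∏ a : K, (Polynomial.X - Polynomial.C (a • α))).Monic :=
    Polynomial.monic_prod_X_sub_C _ _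
  have hdeg' : (∏ a : K, (Polynomial.X - Polynomial.C (a • α))).degree = ((q K : ℕ) : WithBot ℕ) := by
    rw [Polynomial.degree_prod]
    simp
  refine Polynomial.eq_of_degree_sub_lt_of_eval_finset_eq
    (Finset.univ.image fun a : K => a • α) ?_ ?_
  · rw [Finset.card_image_of_injective _ hinj, Finset.card_univ]
    refine (Polynomial.degree_sub_lt_left (hdeg'.trans hdeg.symm) hprod.ne_zero ?_).trans_eq hdeg'
    rw [hprod, hmon]
  · intro t ht
    obtain ⟨a, -, rfl⟩ := Finset.mem_image.1 ht
    rw [Polynomial.eval_prod, Finset.prod_eq_zero (Finset.mem_univ a) (by simp)]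
    simp only [Polynomial.eval_sub, Polynomial.eval_pow, Polynomial.eval_X, Polynomial.eval_mul,
      Polynomial.eval_C]
    rw [smul_pow, FiniteField.pow_card, mul_smul_comm, ← pow_succ, Nat.sub_add_cancel (by omega),
      sub_self]

end Frobenius

/-! ### Linear forms, and the divisors of `d` and `d*` -/

noncomputable section LinearForms

variable {K : Type*} [Field K]

theorem x_prime (i : Fin 2) : Prime (x K i) := X_prime

theorem y_prime (i : Fin 2) : Prime (y K i) := X_prime

theorem x_ne_zero (i : Fin 2) : x K i ≠ 0 := (x_prime i).ne_zero

theorem y_ne_zero (i : Fin 2) : y K i ≠ 0 := (y_prime i).ne_zero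

theorem isRelPrime_x : IsRelPrime (x K 0) (x K 1) := by
  rw [(x_prime 0).irreducible.isRelPrime_iff_not_dvd]
  intro h
  have := map_dvd (aeval (Sum.elim (fun i : Fin 2 => if i = 0 then (0 : K) else 1)
    (fun _ => 0))) h
  simp [x] at this

theorem C_mul_dvd {a : K} (ha : a ≠ 0) {c f : R K} (h : c ∣ C a * f) : c ∣ f := by
  have := h.mul_left (C a⁻¹)
  rwa [← mul_assoc, ← C_mul, inv_mul_cancel₀ ha, C_1, one_mul] at this

theorem isRelPrime_x_sub (a : K) : IsRelPrime (x K 0) (x K 1 - a • x K 0) := by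
  intro c h0 h1
  refine isRelPrime_x h0 ?_
  have := dvd_add h1 (h0.mul_left (C a))
  rwa [smul_eq_C_mul, sub_add_cancel] at this

theorem isRelPrime_sub_sub {a b : K} (hab : a ≠ b) :
    IsRelPrime (x K 1 - a • x K 0) (x K 1 - b • x K 0) := by
  intro c h0 h1
  refine isRelPrime_x_sub b ?_ h1
  refine C_mul_dvd (sub_ne_zero.2 hab.symm) ?_
  have := dvd_sub h0 h1
  rw [smul_eq_C_mul, smul_eq_C_mul] at this
  convert this using 1
  rw [C_sub]; ring

theorem sub_dvd_of_dvd {p : R K} (hp : p ∈ invSLSL K) (h : x K 0 ∣ p) (a : K) :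
    x K 1 - a • x K 0 ∣ p := by
  have h1 := map_dvd (sub !![-a, 1; -1, 0] 1) h
  rw [hp _ _ (by simp [Matrix.det_fin_two]) (by simp), sub_x] at h1
  convert h1 using 1
  simp [smul_eq_C_mul]
  ring

theorem isRelPrime_y_u₀ : IsRelPrime (y K 0) (u₀ K) := by
  rw [(y_prime 0).irreducible.isRelPrime_iff_not_dvd]
  intro h
  have := map_dvd (aeval (Sum.elim (fun _ : Fin 2 => (1 : K))
    (fun i => if i = 0 then (0 : K) else 1))) h
  simp [x, y, u₀] at this

/-- A substitution in the diagonal `GL₂` fixes `u₀` and moves `y 1 - a • y 0` to `y 0`, so this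
follows from `isRelPrime_y_u₀`. -/
theorem isRelPrime_y_sub_u₀ (a : K) : IsRelPrime (y K 1 - a • y K 0) (u₀ K) := by
  intro c h1 h2
  have e1 : (!![0, -1; 1, -a] : Matrix (Fin 2) (Fin 2) K) * !![-a, 1; -1, 0] = 1 := by
    ext i j; fin_cases i <;> fin_cases j <;> simp
  have h3 := map_dvd (sub !![-a, 1; -1, 0].transpose !![0, -1; 1, -a]) h1
  have h4 := map_dvd (sub !![-a, 1; -1, 0].transpose !![0, -1; 1, -a]) h2
  rw [sub_u₀ (by rw [Matrix.transpose_transpose]; exact e1)] at h4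
  have h5 : sub !![-a, 1; -1, 0].transpose !![0, -1; 1, -a] (y K 1 - a • y K 0) = y K 0 := by
    rw [map_sub, map_smul, sub_y, sub_y, smul_eq_C_mul]
    simp
  rw [h5] at h3
  have h6 := (isRelPrime_y_u₀ h3 h4).map (sub !![0, -1; 1, -a].transpose !![-a, 1; -1, 0])
  rwa [sub_sub, e1, ← Matrix.transpose_mul, e1, Matrix.transpose_one, sub_one] at h6

theorem u₀_ne_zero : u₀ K ≠ 0 := by
  intro h
  have h1 := isRelPrime_y_u₀ (K := K)
  rw [h, isRelPrime_zero_right] at h1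
  exact (y_prime 0).not_isUnit h1

variable [Fintype K]

theorem d_eq_prod : d K = - (x K 0 * ∏ a : K, (x K 1 - a • x K 0)) := by
  have h := congrArg (Polynomial.aeval (x K 1)) (prod_X_sub_C_smul (K := K) (x_ne_zero (K := K) 0))
  simp only [map_prod, map_sub, map_mul, map_pow, Polynomial.aeval_X, Polynomial.aeval_C,
    Algebra.algebraMap_self_apply] at h
  obtain ⟨n, hn⟩ : ∃ n, q K = n + 1 := ⟨q K - 1, by have := two_le_q (K := K); omega⟩
  rw [h, d_eq, hn, Nat.add_sub_cancel]
  ring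

theorem dStar_eq_prod : dStar K = y K 0 * ∏ a : K, (y K 1 - a • y K 0) := by
  have h := congrArg (swap K) (d_eq_prod (K := K))
  simpa only [swap_d, map_neg, map_mul, map_prod, map_sub, map_smul, swap_x, neg_inj] using h

theorem d_ne_zero : d K ≠ 0 := by
  rw [d_eq_prod, neg_ne_zero]
  refine mul_ne_zero (x_ne_zero 0) (Finset.prod_ne_zero_iff.2 fun a _ h => ?_)
  have h1 := isRelPrime_x_sub a
  rw [h, isRelPrime_zero_right] at h1
  exact (x_prime 0).not_isUnit h1

theorem dStar_ne_zero : dStar K ≠ 0 := by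
  intro h
  have := congrArg (swap K) h
  rw [swap_dStar, map_zero, neg_eq_zero] at this
  exact d_ne_zero this

/-- As `SL₂` permutes the linear forms transitively, an invariant divisible by one of them is
divisible by all, hence by their product `d`. -/
theorem d_dvd {p : R K} (hp : p ∈ invSLSL K) (h : x K 0 ∣ p) : d K ∣ p := by
  rw [d_eq_prod, neg_dvd]
  refine (IsRelPrime.prod_right fun a _ => isRelPrime_x_sub a).mul_dvd h ?_
  exact Fintype.prod_dvd_of_isRelPrime (fun a b hab => isRelPrime_sub_sub hab)
    (sub_dvd_of_dvd hp h)

theorem isRelPrime_dStar_u₀ : IsRelPrime (dStar K) (u₀ K) := by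
  rw [dStar_eq_prod]
  exact isRelPrime_y_u₀.mul_left (IsRelPrime.prod_left fun a _ => isRelPrime_y_sub_u₀ a)

end LinearForms

/-! ### The polynomials `h_s` and the relations between the generators -/

noncomputable section Relations

variable (K : Type*) [Field K] [Fintype K]

/-- The Cauchy–Binet formula for the product of the matrices with determinants `d` and `d*`. -/
theorem d_mul_dStar : d K * dStar K = u₁ K * u₁Star K - u₀ K ^ (q K + 1) := by
  rw [pow_succ, u₀, add_pow_q, d_eq, dStar_eq, u₁, u₁Star]
  ring

/-- The determinant of the `y_i` and `y_i ^ q²`, which is `h₀ d*`. -/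
def d₂Star : R K := y K 0 * (y K 1 ^ q K) ^ q K - (y K 0 ^ q K) ^ q K * y K 1

theorem dStar_mul_hNum_zero : dStar K * hNum K 0 = d₂Star K * u₀ K ^ q K := by
  have hq := two_le_q (K := K)
  have h1 : dStar K * hNum K 0 = u₁ K * dStar K ^ q K + dStar K * u₁Star K ^ q K := by
    obtain ⟨n, hn⟩ : ∃ n, q K = n + 1 := ⟨q K - 1, by omega⟩
    rw [hNum, hn, Nat.sub_zero, Nat.add_sub_cancel]
    ring
  rw [h1]
  simp only [dStar_eq, u₁, u₁Star, u₀, d₂Star, add_pow_q, sub_pow_q, mul_pow]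
  ring

theorem dStar_mul_hNum_succ {s : ℕ} (hs : s + 2 ≤ q K) :
    dStar K * hNum K (s + 1) =
      u₁ K * hNum K s - u₀ K ^ (q K + 1) * (u₁Star K ^ (q K - s - 1) * d K ^ s) := by
  obtain ⟨n, hn⟩ : ∃ n, q K = s + 2 + n := ⟨q K - (s + 2), by omega⟩
  have h := d_mul_dStar K
  have e1 : q K - (s + 1) - 1 = n := by omega
  have e2 : q K - (s + 1) = n + 1 := by omega
  have e3 : q K - s - 1 = n + 1 := by omega
  have e4 : q K - s = n + 2 := by omega
  rw [hNum, hNum, e1, e2, e3, e4]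
  linear_combination u₁Star K ^ (n + 1) * d K ^ s * h

/-- Modulo `u₀ ^ q`, multiplication by `d*` reduces `hNum (s + 1)` to `hNum s`, and `d*` is prime to
`u₀`. -/
theorem u₀_pow_dvd_hNum {s : ℕ} (hs : s + 1 ≤ q K) : u₀ K ^ q K ∣ hNum K s := by
  have hrel : IsRelPrime (u₀ K ^ q K) (dStar K) := isRelPrime_dStar_u₀.symm.pow_left
  induction s with
  | zero =>
    refine hrel.dvd_of_dvd_mul_left ?_
    rw [dStar_mul_hNum_zero]
    exact dvd_mul_left _ _
  | succ s ih =>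
    refine hrel.dvd_of_dvd_mul_left ?_
    rw [dStar_mul_hNum_succ K (by omega)]
    exact dvd_sub ((ih (by omega)).mul_left _) ((pow_dvd_pow _ (by omega)).mul_right _)

theorem u₀_pow_mul_h {s : ℕ} (hs : s + 1 ≤ q K) : u₀ K ^ q K * h K s = hNum K s := by
  rw [h, dif_pos (u₀_pow_dvd_hNum K hs)]
  exact (u₀_pow_dvd_hNum K hs).choose_spec.symm

theorem u₀_pow_q_ne_zero : u₀ K ^ q K ≠ 0 := pow_ne_zero _ u₀_ne_zero

theorem u₁_mul_h {s : ℕ} (hs : s + 2 ≤ q K) :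
    u₁ K * h K s = dStar K * h K (s + 1) + u₀ K * (u₁Star K ^ (q K - s - 1) * d K ^ s) := by
  apply mul_left_cancel₀ (u₀_pow_q_ne_zero K)
  have h1 := u₀_pow_mul_h K (s := s) (by omega)
  have h2 := u₀_pow_mul_h K (s := s + 1) (by omega)
  have h3 := dStar_mul_hNum_succ K hs
  linear_combination u₁ K * h1 - dStar K * h2 - h3

theorem u₁Star_mul_h {s : ℕ} (hs : s + 2 ≤ q K) :
    u₁Star K * h K (s + 1) =
      d K * h K s + u₀ K * (u₁ K ^ (s + 1) * dStar K ^ (q K - (s + 1) - 1)) := by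
  apply mul_left_cancel₀ (u₀_pow_q_ne_zero K)
  have h1 := u₀_pow_mul_h K (s := s) (by omega)
  have h2 := u₀_pow_mul_h K (s := s + 1) (by omega)
  have h := d_mul_dStar K
  obtain ⟨n, hn⟩ : ∃ n, q K = s + 2 + n := ⟨q K - (s + 2), by omega⟩
  have e1 : q K - (s + 1) - 1 = n := by omega
  have e2 : q K - (s + 1) = n + 1 := by omega
  have e3 : q K - s - 1 = n + 1 := by omega
  have e4 : q K - s = n + 2 := by omega
  rw [hNum, e1, e2] at h2
  rw [hNum, e3, e4] at h1
  rw [e1]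
  linear_combination u₁Star K * h2 - d K * h1 - u₁ K ^ (s + 1) * dStar K ^ n * h

/-- The exchange of variables reverses the sequence of the `hNum s`, up to signs. -/
theorem swap_hNum {s : ℕ} (hs : s + 1 ≤ q K) :
    swap K (hNum K (q K - 1 - s)) = (-1) ^ s * hNum K s := by
  have e1 : q K - 1 - s + 1 = q K - s := by omega
  have e2 : q K - (q K - 1 - s) - 1 = s := by omega
  have e3 : q K - (q K - 1 - s) = s + 1 := by omega
  have e4 : q K - 1 - s = q K - s - 1 := by omega
  have e5 : ((-1) ^ (q K - s - 1) : R K) = (-1) ^ s := by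
    have h1 : ((-1) ^ (q K - s - 1) * (-1) ^ s : R K) = 1 := by
      rw [← pow_add, show q K - s - 1 + s = q K - 1 by omega]
      have := FiniteField.pow_card_sub_one_eq_one (-1 : K) (by simp)
      simpa only [map_pow, map_neg, map_one] using congrArg (C : K → R K) this
    have h2 : ((-1) ^ s * (-1) ^ s : R K) = 1 := by rw [← mul_pow]; simp
    exact mul_right_cancel₀ (pow_ne_zero s (by simp)) (h1.trans h2.symm)
  rw [hNum, hNum, e1, e2, e3, e4]
  simp only [map_add, map_mul, map_pow, swap_u₁, swap_u₁Star, swap_d, swap_dStar]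
  rw [neg_pow (d K), neg_pow (dStar K), e5]
  ring

theorem swap_h {s : ℕ} (hs : s + 1 ≤ q K) :
    swap K (h K (q K - 1 - s)) = (-1) ^ s * h K s := by
  have h1 := congrArg (swap K) (u₀_pow_mul_h K (s := q K - 1 - s) (by omega))
  rw [map_mul, map_pow, swap_u₀, swap_hNum K hs, ← u₀_pow_mul_h K hs] at h1
  apply mul_left_cancel₀ (u₀_pow_q_ne_zero K)
  rw [h1]; ring

theorem dStar_mul_h_zero : dStar K * h K 0 = d₂Star K := by
  apply mul_left_cancel₀ (u₀_pow_q_ne_zero K)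
  have h1 := u₀_pow_mul_h K (s := 0) (by have := two_le_q (K := K); omega)
  linear_combination dStar K * h1 + dStar_mul_hNum_zero K

theorem isSemi_d₂Star : IsSemi 0 1 (d₂Star K) := by
  intro G H _ _
  simp only [d₂Star, map_sub, map_mul, map_pow, sub_y, add_pow_q, C_mul_pow_q, Matrix.det_fin_two]
  simp
  ring

/-- `h₀` is the Dickson invariant of the `y`'s of degree `q² - q`. -/
theorem h_zero_mem : h K 0 ∈ invSLSL K := by
  intro G H hG hH
  apply mul_left_cancel₀ (dStar_ne_zero (K := K))
  conv_lhs => rw [← dStar_mem G H hG hH]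
  rw [← map_mul, dStar_mul_h_zero, (isSemi_d₂Star K).mem_invSLSL G H hG hH]

/-- `h_{q-1}` is the Dickson invariant of the `x`'s of degree `q² - q`. -/
theorem h_last_mem : h K (q K - 1) ∈ invSLSL K := by
  have := swap_h K (s := 0) (by have := two_le_q (K := K); omega)
  rw [pow_zero, one_mul, Nat.sub_zero] at this
  rw [← swap_swap (h K (q K - 1)), this]
  exact swap_mem_invSLSL (h_zero_mem K)

theorem u₁_pow_q : u₁ K ^ q K = h K (q K - 1) * u₀ K ^ q K - d K ^ (q K - 1) * u₁Star K := by
  have hq := two_le_q (K := K)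
  have h1 := u₀_pow_mul_h K (s := q K - 1) (by omega)
  rw [hNum, show q K - 1 + 1 = q K by omega, show q K - (q K - 1) - 1 = 0 by omega,
    show q K - (q K - 1) = 1 by omega] at h1
  linear_combination -h1

theorem u₁Star_pow_q :
    u₁Star K ^ q K = h K 0 * u₀ K ^ q K - dStar K ^ (q K - 1) * u₁ K := by
  have hq := two_le_q (K := K)
  have h1 := u₀_pow_mul_h K (s := 0) (by omega)
  rw [hNum] at h1
  simp only [zero_add, pow_one, Nat.sub_zero, pow_zero, mul_one] at h1
  linear_combination -h1

/-- `h_s` is a semi-invariant of the diagonal `GL₂`. -/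
theorem sub_h {G H : Matrix (Fin 2) (Fin 2) K} (hGH : H * G.transpose = 1) {s : ℕ}
    (hs : s + 1 ≤ q K) : sub G H (h K s) = C (G.det ^ s) * h K s := by
  have hdet : H.det * G.det = 1 := by
    rw [← Matrix.det_transpose G, ← Matrix.det_mul, hGH, Matrix.det_one]
  have hG : G.det ≠ 0 := right_ne_zero_of_mul_eq_one hdet
  have hH : H.det ≠ 0 := left_ne_zero_of_mul_eq_one hdet
  have hd : sub G H (d K) = C G.det * d K := by simpa using isSemi_d G H hG hH
  have hds : sub G H (dStar K) = C H.det * dStar K := by simpa using isSemi_dStar G H hG hH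
  have e : H.det ^ (q K - s - 1) = G.det ^ s := by
    have h1 : H.det ^ (q K - s - 1) * H.det ^ s = 1 := by
      rw [← pow_add, show q K - s - 1 + s = q K - 1 by omega]
      exact FiniteField.pow_card_sub_one_eq_one _ hH
    have h2 : G.det ^ s * H.det ^ s = 1 := by rw [← mul_pow, mul_comm, hdet, one_pow]
    exact mul_right_cancel₀ (pow_ne_zero s hH) (h1.trans h2.symm)
  have h1 := congrArg (sub G H) (u₀_pow_mul_h K hs)
  rw [map_mul, map_pow, sub_u₀ hGH, hNum] at h1
  apply mul_left_cancel₀ (u₀_pow_q_ne_zero K)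
  rw [h1]
  simp only [map_add, map_mul, map_pow, sub_u₁ hGH, sub_u₁Star hGH, hd, hds]
  rw [mul_left_comm, u₀_pow_mul_h K hs, hNum, mul_pow, mul_pow, ← C_pow, ← C_pow, e]
  simp only [map_pow]
  ring

end Relations

/-! ### The span of the generators is stable under `u₀` and `u₁` -/

noncomputable section Generators

variable (K : Type*) [Field K] [Fintype K]

/-- The index type of the `q³ - q` generators of the `SL₂`-invariants, one summand for each of the
three families of the set `D`. -/
abbrev Idx : Type := (Fin (q K) × Fin (q K)) ⊕ (Fin (q K - 1) × Fin (q K - 1) × Fin (q K)) ⊕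
  (Fin (q K - 2) × Fin (q K))

/-- The generators of the `SL₂`-invariants over the `SL₂ × SL₂`-invariants: the elements of `D`
without the factors `d` and `d*`. -/
def gen : Idx K → R K
  | .inl (i, j) => u₁Star K ^ (i : ℕ) * u₁ K ^ (j : ℕ)
  | .inr (.inl (i, j, k)) => u₁Star K ^ (i : ℕ) * u₁ K ^ (j : ℕ) * u₀ K ^ (k + 1 : ℕ)
  | .inr (.inr (s, k)) => h K (s + 1) * u₀ K ^ (k : ℕ)

/-- The `invSLSL`-module spanned by the generators. -/
def genSpan : Submodule (invSLSL K) (R K) := Submodule.span _ (Set.range (gen K))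

variable {K}

theorem smul_mem_genSpan {a f : R K} (ha : a ∈ invSLSL K) (hf : f ∈ genSpan K) :
    a * f ∈ genSpan K :=
  (genSpan K).smul_mem (⟨a, ha⟩ : invSLSL K) hf

theorem gen_mem_genSpan (e : Idx K) : gen K e ∈ genSpan K :=
  Submodule.subset_span ⟨e, rfl⟩

theorem mul_mem_genSpan_of_gen {u : R K} (hu : ∀ e, u * gen K e ∈ genSpan K) {f : R K}
    (hf : f ∈ genSpan K) : u * f ∈ genSpan K := by
  have : genSpan K ≤ (genSpan K).comap (LinearMap.mulLeft (invSLSL K) u) := by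
    rw [genSpan, Submodule.span_le]
    rintro _ ⟨e, rfl⟩
    exact hu e
  exact this hf

theorem pow_mul_mem_genSpan {i j : ℕ} (hi : i < q K) (hj : j < q K) :
    u₁Star K ^ i * u₁ K ^ j ∈ genSpan K :=
  gen_mem_genSpan (.inl (⟨i, hi⟩, ⟨j, hj⟩))

theorem pow_mul_u₀_mem_genSpan {i j k : ℕ} (hi : i + 1 < q K) (hj : j + 1 < q K) (hk : k ≤ q K) :
    u₁Star K ^ i * u₁ K ^ j * u₀ K ^ k ∈ genSpan K := by
  rcases k with _ | k
  · rw [pow_zero, mul_one]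
    exact pow_mul_mem_genSpan (by omega) (by omega)
  · exact gen_mem_genSpan (.inr (.inl (⟨i, by omega⟩, ⟨j, by omega⟩, ⟨k, by omega⟩)))

theorem h_mul_u₀_mem_genSpan {s k : ℕ} (hs : s + 2 < q K) (hk : k < q K) :
    h K (s + 1) * u₀ K ^ k ∈ genSpan K :=
  gen_mem_genSpan (.inr (.inr (⟨s, by omega⟩, ⟨k, hk⟩)))

theorem h_mul_u₁_pow_mem_genSpan {j : ℕ} (hj : j < q K) {s : ℕ} (hs : s + 1 < q K) :
    h K (s + 1) * u₁ K ^ j ∈ genSpan K := by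
  have hq := two_le_q (K := K)
  induction j generalizing s with
  | zero =>
    rcases Nat.lt_or_ge (s + 2) (q K) with h1 | h1
    · simpa using h_mul_u₀_mem_genSpan (k := 0) h1 (by omega)
    · rw [show s + 1 = q K - 1 by omega, pow_zero]
      exact smul_mem_genSpan (h_last_mem K)
        (by simpa using pow_mul_mem_genSpan (K := K) (i := 0) (j := 0) (by omega) (by omega))
  | succ j ih =>
    rcases Nat.lt_or_ge (s + 2) (q K) with h1 | h1
    · have h2 := u₁_mul_h K (s := s + 1) (by omega)
      have h3 : h K (s + 1) * u₁ K ^ (j + 1) = dStar K * (h K (s + 1 + 1) * u₁ K ^ j) +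
          d K ^ (s + 1) * (u₁Star K ^ (q K - (s + 1) - 1) * u₁ K ^ j * u₀ K ^ 1) := by
        linear_combination u₁ K ^ j * h2
      rw [h3]
      refine add_mem (smul_mem_genSpan dStar_mem (ih (by omega) (by omega)))
        (smul_mem_genSpan (pow_mem d_mem _) (pow_mul_u₀_mem_genSpan (by omega) (by omega) ?_))
      omega
    · rw [show s + 1 = q K - 1 by omega]
      refine smul_mem_genSpan (h_last_mem K) ?_
      simpa using pow_mul_mem_genSpan (K := K) (i := 0) (j := j + 1) (by omega) (by omega)

theorem u₁Star_pow_mul_h_mem_genSpan {i : ℕ} (hi : i < q K) {s : ℕ} (hs : s + 1 < q K) :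
    u₁Star K ^ i * h K s ∈ genSpan K := by
  have hq := two_le_q (K := K)
  induction i generalizing s with
  | zero =>
    rcases s with _ | s
    · rw [mul_comm]
      refine smul_mem_genSpan (h_zero_mem K) ?_
      simpa using pow_mul_mem_genSpan (K := K) (i := 0) (j := 0) (by omega) (by omega)
    · simpa using h_mul_u₀_mem_genSpan (K := K) (s := s) (k := 0) (by omega) (by omega)
  | succ i ih =>
    rcases s with _ | s
    · rw [mul_comm]
      refine smul_mem_genSpan (h_zero_mem K) ?_
      simpa using pow_mul_mem_genSpan (K := K) (i := i + 1) (j := 0) (by omega) (by omega)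
    · have h2 := u₁Star_mul_h K (s := s) (by omega)
      have h3 : u₁Star K ^ (i + 1) * h K (s + 1) = d K * (u₁Star K ^ i * h K s) +
          dStar K ^ (q K - (s + 1) - 1) * (u₁Star K ^ i * u₁ K ^ (s + 1) * u₀ K ^ 1) := by
        linear_combination u₁Star K ^ i * h2
      rw [h3]
      refine add_mem (smul_mem_genSpan d_mem (ih (by omega) (by omega)))
        (smul_mem_genSpan (pow_mem dStar_mem _) (pow_mul_u₀_mem_genSpan (by omega) (by omega) ?_))
      omega

theorem u₁_pow_mem_genSpan {j : ℕ} (hj : j ≤ q K) : u₁ K ^ j ∈ genSpan K := by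
  have hq := two_le_q (K := K)
  rcases hj.lt_or_eq with h1 | rfl
  · simpa using pow_mul_mem_genSpan (K := K) (i := 0) (j := j) (by omega) h1
  · rw [u₁_pow_q]
    refine sub_mem (smul_mem_genSpan (h_last_mem K) ?_)
      (smul_mem_genSpan (pow_mem d_mem _) ?_)
    · simpa using pow_mul_u₀_mem_genSpan (K := K) (i := 0) (j := 0) (by omega) (by omega) le_rfl
    · simpa using pow_mul_mem_genSpan (K := K) (i := 1) (j := 0) (by omega) (by omega)

theorem u₁Star_pow_mem_genSpan {i : ℕ} (hi : i ≤ q K) : u₁Star K ^ i ∈ genSpan K := by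
  have hq := two_le_q (K := K)
  rcases hi.lt_or_eq with h1 | rfl
  · simpa using pow_mul_mem_genSpan (K := K) (i := i) (j := 0) h1 (by omega)
  · rw [u₁Star_pow_q]
    refine sub_mem (smul_mem_genSpan (h_zero_mem K) ?_)
      (smul_mem_genSpan (pow_mem dStar_mem _) ?_)
    · simpa using pow_mul_u₀_mem_genSpan (K := K) (i := 0) (j := 0) (by omega) (by omega) le_rfl
    · simpa using pow_mul_mem_genSpan (K := K) (i := 0) (j := 1) (by omega) (by omega)

theorem u₀_mul_pow_mem_genSpan {i j : ℕ} (hi : i < q K) (hj : j < q K) :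
    u₀ K * (u₁Star K ^ i * u₁ K ^ j) ∈ genSpan K := by
  have hq := two_le_q (K := K)
  rcases Nat.lt_or_ge (i + 1) (q K) with hi' | hi'
  · rcases Nat.lt_or_ge (j + 1) (q K) with hj' | hj'
    · have := pow_mul_u₀_mem_genSpan (k := 1) hi' hj' (by omega)
      rwa [pow_one, mul_comm] at this
    · obtain ⟨n, hn⟩ : ∃ n, q K = n + 2 := ⟨q K - 2, by omega⟩
      have h1 := u₁Star_mul_h K (s := n) (by omega)
      rw [show q K - (n + 1) - 1 = 0 by omega, show n + 1 = q K - 1 by omega] at h1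
      have h2 : u₀ K * (u₁Star K ^ i * u₁ K ^ (q K - 1)) =
          h K (q K - 1) * u₁Star K ^ (i + 1) - d K * (u₁Star K ^ i * h K n) := by
        linear_combination -u₁Star K ^ i * h1
      rw [show j = q K - 1 by omega, h2]
      exact sub_mem (smul_mem_genSpan (h_last_mem K) (u₁Star_pow_mem_genSpan (by omega)))
        (smul_mem_genSpan d_mem (u₁Star_pow_mul_h_mem_genSpan hi (by omega)))
  · have h1 := u₁_mul_h K (s := 0) (by omega)
    rw [Nat.sub_zero, zero_add, pow_zero] at h1
    have h2 : u₀ K * (u₁Star K ^ (q K - 1) * u₁ K ^ j) =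
        h K 0 * u₁ K ^ (j + 1) - dStar K * (h K (0 + 1) * u₁ K ^ j) := by
      linear_combination -u₁ K ^ j * h1
    rw [show i = q K - 1 by omega, h2]
    exact sub_mem (smul_mem_genSpan (h_zero_mem K) (u₁_pow_mem_genSpan (by omega)))
      (smul_mem_genSpan dStar_mem (h_mul_u₁_pow_mem_genSpan hj (by omega)))

theorem u₀_mul_mem_genSpan {f : R K} (hf : f ∈ genSpan K) : u₀ K * f ∈ genSpan K := by
  have hq := two_le_q (K := K)
  refine mul_mem_genSpan_of_gen ?_ hf
  rintro (⟨i, j⟩ | ⟨i, j, k⟩ | ⟨s, k⟩)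
  · exact u₀_mul_pow_mem_genSpan i.2 j.2
  · have hi := i.2
    have hj := j.2
    rcases Nat.lt_or_ge (k + 1 : ℕ) (q K) with hk | hk
    · have := pow_mul_u₀_mem_genSpan (K := K) (i := i) (j := j) (k := k + 2) (by omega) (by omega)
        (by omega)
      convert this using 1
      simp only [gen]; ring
    · have hk' : (k + 1 : ℕ) = q K := by omega
      have h1 : u₀ K * gen K (.inr (.inl (i, j, k))) =
          u₁Star K ^ (i + 1 : ℕ) * u₁ K ^ (j + 1 : ℕ) -
            d K * (dStar K * (u₁Star K ^ (i : ℕ) * u₁ K ^ (j : ℕ))) := by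
        simp only [gen, hk']
        linear_combination (u₁Star K ^ (i : ℕ) * u₁ K ^ (j : ℕ)) * d_mul_dStar K
      rw [h1]
      exact sub_mem (pow_mul_mem_genSpan (by omega) (by omega))
        (smul_mem_genSpan d_mem (smul_mem_genSpan dStar_mem
          (pow_mul_mem_genSpan (by omega) (by omega))))
  · have hs := s.2
    rcases Nat.lt_or_ge (k + 1 : ℕ) (q K) with hk | hk
    · have := h_mul_u₀_mem_genSpan (K := K) (s := s) (k := k + 1) (by omega) hk
      convert this using 1
      simp only [gen]; ring
    · have hk' : (k + 1 : ℕ) = q K := by omega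
      have h1 : u₀ K * gen K (.inr (.inr (s, k))) = u₀ K ^ q K * h K (s + 1) := by
        simp only [gen, ← hk']; ring
      rw [h1, u₀_pow_mul_h K (by omega), hNum, mul_comm (u₁ K ^ _), mul_comm (u₁Star K ^ _)]
      exact add_mem (smul_mem_genSpan (pow_mem dStar_mem _) (u₁_pow_mem_genSpan (by omega)))
        (smul_mem_genSpan (pow_mem d_mem _) (u₁Star_pow_mem_genSpan (by omega)))

theorem u₀_pow_mul_mem_genSpan (k : ℕ) {f : R K} (hf : f ∈ genSpan K) :
    u₀ K ^ k * f ∈ genSpan K := by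
  induction k with
  | zero => simpa using hf
  | succ k ih =>
    rw [pow_succ', mul_assoc]
    exact u₀_mul_mem_genSpan ih

theorem u₁_mul_pow_mem_genSpan {i j : ℕ} (hi : i < q K) (hj : j < q K) :
    u₁ K * (u₁Star K ^ i * u₁ K ^ j) ∈ genSpan K := by
  have hq := two_le_q (K := K)
  rcases Nat.lt_or_ge (j + 1) (q K) with hj' | hj'
  · have := pow_mul_mem_genSpan hi hj'
    convert this using 1
    ring
  · obtain rfl : j = q K - 1 := by omega
    have h1 : u₁ K * (u₁Star K ^ i * u₁ K ^ (q K - 1)) =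
        h K (q K - 1) * (u₀ K ^ q K * (u₁Star K ^ i * u₁ K ^ 0)) -
          d K ^ (q K - 1) * u₁Star K ^ (i + 1) := by
      have h2 : u₁ K * u₁ K ^ (q K - 1) = u₁ K ^ q K := by
        rw [← pow_succ', Nat.sub_add_cancel (by omega)]
      linear_combination u₁Star K ^ i * (h2 + u₁_pow_q K)
    rw [h1]
    exact sub_mem (smul_mem_genSpan (h_last_mem K) (u₀_pow_mul_mem_genSpan _
      (pow_mul_mem_genSpan hi (by omega))))
      (smul_mem_genSpan (pow_mem d_mem _) (u₁Star_pow_mem_genSpan (by omega)))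

theorem u₁_mul_mem_genSpan {f : R K} (hf : f ∈ genSpan K) : u₁ K * f ∈ genSpan K := by
  have hq := two_le_q (K := K)
  refine mul_mem_genSpan_of_gen ?_ hf
  rintro (⟨i, j⟩ | ⟨i, j, k⟩ | ⟨s, k⟩)
  · exact u₁_mul_pow_mem_genSpan i.2 j.2
  · have := u₀_pow_mul_mem_genSpan (k + 1 : ℕ)
      (u₁_mul_pow_mem_genSpan (K := K) (i := i) (j := j) (by omega) (by omega))
    convert this using 1
    simp only [gen]; ring
  · have := u₀_pow_mul_mem_genSpan (k : ℕ)
      (h_mul_u₁_pow_mem_genSpan (K := K) (j := 1) (s := s) (by omega) (by omega))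
    convert this using 1
    simp only [gen]; ring

theorem u₀_pow_mul_u₁_pow_mem_genSpan (a b : ℕ) : u₀ K ^ a * u₁ K ^ b ∈ genSpan K := by
  refine u₀_pow_mul_mem_genSpan a ?_
  induction b with
  | zero => exact u₁_pow_mem_genSpan (Nat.zero_le _)
  | succ b ih =>
    rw [pow_succ']
    exact u₁_mul_mem_genSpan ih

end Generators

/-! ### Invariants after inversion of `d` -/

noncomputable section InvertD

variable {K : Type*} [Field K] [Fintype K]

/-- The substitution expressing the `y`'s, up to the factor `d`, by indeterminates `X 0` and `X 1`
that stand for `u₀` and `u₁`. -/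
def toU : R K →ₐ[K] MvPolynomial (Fin 2) (R K) :=
  aeval (Sum.elim (fun i => C (x K i))
    ![C (x K 1) * X 1 - C (x K 1 ^ q K) * X 0, C (x K 0 ^ q K) * X 0 - C (x K 0) * X 1])

theorem toU_x (i : Fin 2) : toU (x K i) = C (x K i) := by
  conv_lhs => rw [x, toU, aeval_X]
  simp

theorem toU_y_zero : toU (y K 0) = C (x K 1) * X 1 - C (x K 1 ^ q K) * X 0 := by
  conv_lhs => rw [y, toU, aeval_X]
  simp

theorem toU_y_one : toU (y K 1) = C (x K 0 ^ q K) * X 0 - C (x K 0) * X 1 := by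
  conv_lhs => rw [y, toU, aeval_X]
  simp

theorem toU_C (a : K) : toU (C a) = C (C a) := toU.commutes a

theorem sub_x_pow_q (G H : Matrix (Fin 2) (Fin 2) K) (i : Fin 2) :
    sub G H (x K i ^ q K) = C (G i 0) * x K 0 ^ q K + C (G i 1) * x K 1 ^ q K := by
  rw [map_pow, sub_x, add_pow_q, C_mul_pow_q, C_mul_pow_q]

/-- Equivariance of `toU`, where `SL₂` acts on the coefficients only and fixes the indeterminates.
The action `H'` on the `y`'s is arbitrary since they do not occur in the coefficients. -/
theorem map_toU {G H H' : Matrix (Fin 2) (Fin 2) K} (hG : G.det = 1) (hGH : H * G.transpose = 1)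
    (f : R K) : map (sub G H' : R K →+* R K) (toU f) = toU (sub G H f) := by
  have e : H = !![G 1 1, -G 1 0; -G 0 1, G 0 0] := by
    have h1 : !![G 1 1, -G 1 0; -G 0 1, G 0 0] * G.transpose = 1 := by
      rw [Matrix.det_fin_two] at hG
      ext i j
      fin_cases i <;> fin_cases j <;> simp [Matrix.mul_apply, Fin.sum_univ_two] <;>
        first | linear_combination hG | ring
    rw [← Matrix.inv_eq_left_inv hGH, Matrix.inv_eq_left_inv h1]
  have : (mapAlgHom (sub G H')).comp toU = toU.comp (sub G H) := by
    apply algHom_ext_xy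
    · intro i
      simp only [AlgHom.comp_apply, toU_x, mapAlgHom_apply, map_C, RingHom.coe_coe, sub_x, map_add,
        map_mul, toU_C]
    · intro i
      fin_cases i <;>
      simp only [AlgHom.comp_apply, toU_y_zero, toU_y_one, mapAlgHom_apply, map_C, map_X,
        RingHom.coe_coe, sub_x, sub_x_pow_q, sub_y, map_add, map_sub, map_mul, toU_C, Fin.zero_eta,
        Fin.mk_one, e, Matrix.of_apply, Matrix.cons_val_zero, Matrix.cons_val_one,
        Matrix.cons_val_fin_one, map_neg] <;>
      ring
  exact DFunLike.congr_fun this f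

theorem coeff_toU_mem {f : R K} (hf : ∀ G H : Matrix (Fin 2) (Fin 2) K, G.det = 1 →
    H * G.transpose = 1 → sub G H f = f) (m : Fin 2 →₀ ℕ) : (toU f).coeff m ∈ invSLSL K := by
  intro G H' hG _
  have hu : IsUnit G.transpose.det := by rw [Matrix.det_transpose, hG]; exact isUnit_one
  have hGH := Matrix.nonsing_inv_mul _ hu
  have h1 := map_toU (H' := H') hG hGH f
  rw [hf _ _ hG hGH] at h1
  have h2 := congrArg (coeff m) h1
  rwa [coeff_map] at h2

/-- After inversion of `d` the functions `u₀` and `u₁` are coordinates replacing `y 0` and `y 1`,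
and they are invariant; so a polynomial in them is invariant only if its coefficients are. -/
theorem exists_d_pow_mul_mem_genSpan {f : R K} (hf : ∀ G H : Matrix (Fin 2) (Fin 2) K,
    G.det = 1 → H * G.transpose = 1 → sub G H f = f) : ∃ N, d K ^ N * f ∈ genSpan K := by
  classical
  let ι := algebraMap (R K) (FractionRing (R K))
  have hι : Function.Injective ι := IsFractionRing.injective _ _
  have hd : ι (d K) ≠ 0 := (map_ne_zero_iff ι hι).2 d_ne_zero
  let g : Fin 2 → FractionRing (R K) := ![ι (u₀ K) / ι (d K), ι (u₁ K) / ι (d K)]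
  have hcomp : ((aeval g).restrictScalars K).comp (toU (K := K)) =
      IsScalarTower.toAlgHom K (R K) (FractionRing (R K)) := by
    apply algHom_ext_xy
    · intro i
      simp [toU_x]
    · intro i
      fin_cases i
      · have h1 : x K 1 * u₁ K - x K 1 ^ q K * u₀ K = d K * y K 0 := by
          rw [u₁, u₀, d_eq]; ring
        have h2 := congrArg ι h1
        simp only [map_sub, map_mul, map_pow] at h2
        simp only [Fin.zero_eta, AlgHom.comp_apply, toU_y_zero, AlgHom.restrictScalars_apply,
          map_sub, map_mul, aeval_C, aeval_X, map_pow, IsScalarTower.toAlgHom_apply]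
        change ι _ * (ι _ / ι _) - ι _ ^ _ * (ι _ / ι _) = ι _
        field_simp
        linear_combination h2
      · have h1 : x K 0 ^ q K * u₀ K - x K 0 * u₁ K = d K * y K 1 := by
          rw [u₁, u₀, d_eq]; ring
        have h2 := congrArg ι h1
        simp only [map_sub, map_mul, map_pow] at h2
        simp only [Fin.mk_one, AlgHom.comp_apply, toU_y_one, AlgHom.restrictScalars_apply,
          map_sub, map_mul, aeval_C, aeval_X, map_pow, IsScalarTower.toAlgHom_apply]
        change ι _ ^ _ * (ι _ / ι _) - ι _ * (ι _ / ι _) = ι _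
        field_simp
        linear_combination h2
  have hsum : ι f = ∑ m ∈ (toU f).support, ι ((toU f).coeff m) *
      ((ι (u₀ K) / ι (d K)) ^ m 0 * (ι (u₁ K) / ι (d K)) ^ m 1) := by
    have h1 := DFunLike.congr_fun hcomp f
    rw [AlgHom.comp_apply, AlgHom.restrictScalars_apply, aeval_def, eval₂_eq'] at h1
    refine Eq.trans h1.symm (Finset.sum_congr rfl fun m _ => ?_)
    rw [Fin.prod_univ_two]
    rfl
  let N := ∑ m ∈ (toU f).support, (m 0 + m 1)
  refine ⟨N, ?_⟩
  have key : d K ^ N * f = ∑ m ∈ (toU f).support, (toU f).coeff m * (d K ^ (N - (m 0 + m 1)) *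
      (u₀ K ^ m 0 * u₁ K ^ m 1)) := by
    apply hι
    rw [map_mul, hsum, map_sum, Finset.mul_sum]
    refine Finset.sum_congr rfl fun m hm => ?_
    have hle : m 0 + m 1 ≤ N :=
      Finset.single_le_sum (f := fun m : Fin 2 →₀ ℕ => m 0 + m 1) (fun _ _ => Nat.zero_le _) hm
    have hN : ι (d K) ^ N = ι (d K) ^ (N - (m 0 + m 1)) * (ι (d K) ^ m 0 * ι (d K) ^ m 1) := by
      rw [← pow_add, ← pow_add, Nat.sub_add_cancel hle]
    simp only [map_mul, map_pow, div_pow, hN]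
    field_simp
  rw [key]
  exact sum_mem fun m _ => smul_mem_genSpan (coeff_toU_mem hf m)
    (smul_mem_genSpan (pow_mem d_mem _) (u₀_pow_mul_u₁_pow_mem_genSpan _ _))

end InvertD

/-! ### Exponents of the generators on the line `x 0 = 0` -/

section Exponents

/-- The monomial `u₁*^i u₁^j u₀^k` restricts to `x ^ (i + q j + k) * y ^ (q i + j + k)` on the line
`x 0 = 0`. For the triples that belong to generators, the residues of these two exponents modulo
`q (q - 1)` and `q² - 1` determine the triple. -/
theorem exponents_injective {q i j k i' j' k' m n : ℤ} (hq : 2 ≤ q)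
    (hi : -1 ≤ i) (hiq : i ≤ q - 1) (hj : 0 ≤ j) (hjq : j ≤ q - 1) (hk : 0 ≤ k) (hkq : k ≤ q)
    (hi' : -1 ≤ i') (hiq' : i' ≤ q - 1) (hj' : 0 ≤ j') (hjq' : j' ≤ q - 1) (hk' : 0 ≤ k')
    (hkq' : k' ≤ q)
    (hneg : i = -1 → 1 ≤ j ∧ 1 ≤ k) (hneg' : i' = -1 → 1 ≤ j' ∧ 1 ≤ k')
    (htop : i = q - 1 ∨ j = q - 1 → k = 0) (htop' : i' = q - 1 ∨ j' = q - 1 → k' = 0)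
    (hE : (i' + q * j' + k') - (i + q * j + k) = q * (q - 1) * m)
    (hF : (q * i' + j' + k') - (q * i + j + k) = (q * q - 1) * n) :
    i = i' ∧ j = j' ∧ k = k' := by
  -- the total degrees differ by a multiple `c` of `q - 1`
  obtain ⟨c, hc⟩ : ∃ c, c = q * m - (j' - j) := ⟨_, rfl⟩
  have h1 : (i' + j' + k') - (i + j + k) = (q - 1) * c := by rw [hc]; linear_combination hE
  have h2 : (i' + j' + k') - (i + j + k) = (q - 1) * ((q + 1) * n - (i' - i)) := by
    linear_combination hF
  have h3 : c = (q + 1) * n - (i' - i) :=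
    mul_left_cancel₀ (show q - 1 ≠ 0 by omega) (h1.symm.trans h2)
  have hw : i + j + k ≤ 3 * q - 3 := by omega
  have hw' : i' + j' + k' ≤ 3 * q - 3 := by omega
  have hw0 : 0 ≤ i + j + k := by omega
  have hw0' : 0 ≤ i' + j' + k' := by omega
  -- everything is bounded by small multiples of `q`, which leaves finitely many linear cases
  have hc1 : c ≤ 3 := by nlinarith
  have hc2 : -3 ≤ c := by nlinarith
  have hm1 : m ≤ 2 := by nlinarith
  have hm2 : -2 ≤ m := by nlinarith
  have hn1 : n ≤ 2 := by nlinarith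
  have hn2 : -2 ≤ n := by nlinarith
  clear hE hF h2
  interval_cases c <;> interval_cases m <;> (try omega) <;> interval_cases n <;> omega

end Exponents

section GeneratorExponents

variable {K : Type*} [Fintype K]

/-- The exponent of `x 1` in the restriction of a generator to the line `x 0 = 0`. -/
def xExp : Idx K → ℕ
  | .inl (i, j) => i + q K * j
  | .inr (.inl (i, j, k)) => i + q K * j + (k + 1)
  | .inr (.inr (s, k)) => q K * (s + 1) + k

/-- The exponent of `y 1` in the restriction of a generator to the line `x 0 = 0`, as a monomial
over the invariants and increased by `q - 2`. -/
def yExp : Idx K → ℕ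
  | .inl (i, j) => q K - 2 + (q K * i + j)
  | .inr (.inl (i, j, k)) => q K - 2 + (q K * i + j + (k + 1))
  | .inr (.inr (s, k)) => s + k

/-- The exponent of `d*` in the restriction of a generator to the line `x 0 = 0`. -/
def dExp : Idx K → ℕ
  | .inl _ => 0
  | .inr (.inl _) => 0
  | .inr (.inr (s, _)) => q K - 2 - s

/-- The exponents `(i, j, k)` of `u₁*`, `u₁` and `u₀` in the restriction of a generator to the line
`x 0 = 0`, where `h_s` restricts to `u₁*⁻¹ u₁^s u₀` up to invariants. -/
def uExp : Idx K → ℤ × ℤ × ℤ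
  | .inl (i, j) => (i, j, 0)
  | .inr (.inl (i, j, k)) => (i, j, k + 1)
  | .inr (.inr (s, k)) => (-1, s + 1, k + 1)

theorem uExp_injective : Function.Injective (uExp (K := K)) := by
  rintro (⟨i, j⟩ | ⟨i, j, k⟩ | ⟨s, k⟩) (⟨i', j'⟩ | ⟨i', j', k'⟩ | ⟨s', k'⟩) h <;>
    simp only [uExp, Prod.mk.injEq] at h <;>
    first
    | (exfalso; omega)
    | (simp only [Sum.inl.injEq, Sum.inr.injEq, Prod.mk.injEq, Fin.ext_iff]; omega)

theorem xExp_eq (e : Idx K) :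
    (xExp e : ℤ) = (uExp e).1 + q K * (uExp e).2.1 + (uExp e).2.2 := by
  rcases e with ⟨i, j⟩ | ⟨i, j, k⟩ | ⟨s, k⟩ <;> simp only [xExp, uExp] <;> push_cast <;> ring

variable [Field K]

theorem yExp_lt (e : Idx K) : yExp e < q K * q K - 1 + (q K - 1) := by
  have hq := two_le_q (K := K)
  obtain ⟨n, hn⟩ : ∃ n, q K = n + 2 := ⟨q K - 2, by omega⟩
  rcases e with ⟨i, j⟩ | ⟨i, j, k⟩ | ⟨s, k⟩
  · have hi := i.2
    have hj := j.2
    simp only [yExp]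
    generalize (i : ℕ) = i at *
    generalize (j : ℕ) = j at *
    rw [hn] at *
    have : (n + 2) * i ≤ (n + 2) * (n + 1) := Nat.mul_le_mul_left _ (by omega)
    have h2 : (n + 2) * (n + 2) = (n + 2) * (n + 1) + (n + 2) := by ring
    omega
  · have hi := i.2
    have hj := j.2
    have hk := k.2
    simp only [yExp]
    generalize (i : ℕ) = i at *
    generalize (j : ℕ) = j at *
    generalize (k : ℕ) = k at *
    rw [hn] at *
    have : (n + 2) * i ≤ (n + 2) * n := Nat.mul_le_mul_left _ (by omega)
    have h2 : (n + 2) * (n + 2) = (n + 2) * n + (n + 2) + (n + 2) := by ring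
    omega
  · have hs := s.2
    have hk := k.2
    simp only [yExp]
    have h2 : q K * 2 ≤ q K * q K := Nat.mul_le_mul_left _ hq
    omega

theorem yExp_eq (e : Idx K) :
    (yExp e : ℤ) = q K - 2 + (q K * (uExp e).1 + (uExp e).2.1 + (uExp e).2.2) := by
  have hq := two_le_q (K := K)
  rcases e with ⟨i, j⟩ | ⟨i, j, k⟩ | ⟨s, k⟩ <;> simp only [yExp, uExp] <;> push_cast [hq] <;> ring

theorem uExp_bounds (e : Idx K) : -1 ≤ (uExp e).1 ∧ (uExp e).1 ≤ q K - 1 ∧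
    0 ≤ (uExp e).2.1 ∧ (uExp e).2.1 ≤ q K - 1 ∧ 0 ≤ (uExp e).2.2 ∧ (uExp e).2.2 ≤ q K ∧
    ((uExp e).1 = -1 → 1 ≤ (uExp e).2.1 ∧ 1 ≤ (uExp e).2.2) ∧
    ((uExp e).1 = q K - 1 ∨ (uExp e).2.1 = q K - 1 → (uExp e).2.2 = 0) := by
  have hq := two_le_q (K := K)
  rcases e with ⟨i, j⟩ | ⟨i, j, k⟩ | ⟨s, k⟩
  · have := i.2
    have := j.2
    simp only [uExp]
    refine ⟨?_, ?_, ?_, ?_, ?_, ?_, ?_, fun _ => trivial⟩ <;> omega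
  · have := i.2
    have := j.2
    have := k.2
    simp only [uExp]
    omega
  · have := s.2
    have := k.2
    simp only [uExp]
    omega

theorem eq_of_exp_modEq {e e' : Idx K} (hE : xExp e ≡ xExp e' [MOD q K * (q K - 1)])
    (hF : yExp e ≡ yExp e' [MOD q K * q K - 1]) : e = e' := by
  have hq := two_le_q (K := K)
  have hqq : 1 ≤ q K * q K := by nlinarith
  obtain ⟨m, hm⟩ := hE.dvd
  obtain ⟨n, hn⟩ := hF.dvd
  rw [xExp_eq, xExp_eq] at hm
  rw [yExp_eq, yExp_eq] at hn
  push_cast [show 1 ≤ q K by omega, hqq] at hm hn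
  obtain ⟨a1, a2, a3, a4, a5, a6, a7, a8⟩ := uExp_bounds e
  obtain ⟨b1, b2, b3, b4, b5, b6, b7, b8⟩ := uExp_bounds e'
  obtain ⟨h1, h2, h3⟩ := exponents_injective (n := n) (by exact_mod_cast hq) a1 a2 a3 a4 a5 a6
    b1 b2 b3 b4 b5 b6 a7 b7 a8 b8 hm (by linear_combination hn)
  exact uExp_injective (Prod.ext h1 (Prod.ext h2 h3))

end GeneratorExponents

/-! ### Restriction to the line `x 0 = 0` -/

noncomputable section Restriction

/-- A polynomial invariant under translation by all multiples of `α` is a polynomial in the product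
of its translates `X - a α`. -/
theorem exists_eq_comp_of_translation {K A : Type*} [Field K] [Fintype K] [CommRing A] [IsDomain A]
    [Algebra K A] {α : A} (hα : α ≠ 0) (f : Polynomial A)
    (hf : ∀ a : K, f.comp (Polynomial.X + Polynomial.C (a • α)) = f) :
    ∃ g : Polynomial A, f = g.comp (∏ a : K, (Polynomial.X - Polynomial.C (a • α))) := by
  classical
  set N : Polynomial A := ∏ a : K, (Polynomial.X - Polynomial.C (a • α)) with hN
  have hNmon : N.Monic := Polynomial.monic_prod_X_sub_C _ _
  have hNdeg : N.natDegree = Fintype.card K := by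
    rw [hN, Polynomial.natDegree_prod_of_monic _ _ fun a _ => Polynomial.monic_X_sub_C _]
    simp
  have hNtr : ∀ a : K, N.comp (Polynomial.X + Polynomial.C (a • α)) = N := by
    intro a
    rw [hN, Polynomial.prod_comp]
    refine Fintype.prod_equiv (Equiv.subRight a) _ _ fun b => ?_
    simp only [Polynomial.sub_comp, Polynomial.X_comp, Polynomial.C_comp, Equiv.subRight_apply,
      sub_smul, Polynomial.C_sub]
    ring
  have hinj : Function.Injective fun a : K => a • α := smul_left_injective K hα
  induction hn : f.natDegree using Nat.strong_induction_on generalizing f with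
  | _ n ih =>
    have hdvd : N ∣ f - Polynomial.C (f.eval 0) := by
      by_cases h0 : f - Polynomial.C (f.eval 0) = 0
      · rw [h0]; exact dvd_zero _
      · have hs : (Finset.univ.val.map fun a : K => a • α) ≤
            (f - Polynomial.C (f.eval 0)).roots := by
          rw [Multiset.le_iff_subset (Finset.univ.nodup.map hinj)]
          intro t ht
          obtain ⟨a, -, rfl⟩ := Multiset.mem_map.1 ht
          rw [Polynomial.mem_roots h0, Polynomial.IsRoot.def, Polynomial.eval_sub,
            Polynomial.eval_C, sub_eq_zero]
          conv_rhs => rw [← hf a]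
          rw [Polynomial.eval_comp]
          simp
        have := (Multiset.prod_X_sub_C_dvd_iff_le_roots h0 _).2 hs
        rwa [Multiset.map_map] at this
    obtain ⟨g, hg⟩ := hdvd
    by_cases hg0 : g = 0
    · refine ⟨Polynomial.C (f.eval 0), ?_⟩
      rw [hg0, mul_zero, sub_eq_zero] at hg
      rw [Polynomial.C_comp]
      exact hg
    · have hgtr : ∀ a : K, g.comp (Polynomial.X + Polynomial.C (a • α)) = g := by
        intro a
        apply mul_left_cancel₀ hNmon.ne_zero
        conv_lhs => rw [← hNtr a]
        rw [← Polynomial.mul_comp, ← hg, Polynomial.sub_comp, hf, Polynomial.C_comp]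
      have hlt : g.natDegree < n := by
        have h1 := congrArg Polynomial.natDegree hg
        rw [Polynomial.natDegree_sub_C, hNmon.natDegree_mul' hg0, hNdeg, hn] at h1
        have := Fintype.card_pos (α := K)
        omega
      obtain ⟨g', hg'⟩ := ih _ hlt g hgtr rfl
      refine ⟨Polynomial.C (f.eval 0) + Polynomial.X * g', ?_⟩
      rw [Polynomial.add_comp, Polynomial.mul_comp, Polynomial.C_comp, Polynomial.X_comp, ← hg',
        ← hg]
      ring

variable {K : Type*} [Field K]

/-- The expansion of a polynomial in powers of the variable `x 1`. -/
def expandX : R K →ₐ[K] Polynomial (R K) :=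
  aeval (Sum.elim ![Polynomial.C (x K 0), Polynomial.X] (fun i => Polynomial.C (y K i)))

/-- The restriction to `x 0 = 0`, as a polynomial in the remaining variable `x 1`. -/
def restr : R K →ₐ[K] Polynomial (R K) :=
  aeval (Sum.elim ![0, Polynomial.X] (fun i => Polynomial.C (y K i)))

/-- The substitution `x 0 ↦ 0`. -/
def kill : R K →ₐ[K] R K := aeval (Sum.elim ![0, x K 1] (y K))

theorem expandX_x_zero : expandX (x K 0) = Polynomial.C (x K 0) := by
  conv_lhs => rw [x, expandX, aeval_X]
  rfl

theorem expandX_x_one : expandX (x K 1) = Polynomial.X := by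
  conv_lhs => rw [x, expandX, aeval_X]
  rfl

theorem expandX_y (i : Fin 2) : expandX (y K i) = Polynomial.C (y K i) := by
  conv_lhs => rw [y, expandX, aeval_X]
  rfl

theorem restr_x_zero : restr (x K 0) = 0 := by
  conv_lhs => rw [x, restr, aeval_X]
  rfl

theorem restr_x_one : restr (x K 1) = Polynomial.X := by
  conv_lhs => rw [x, restr, aeval_X]
  rfl

theorem restr_y (i : Fin 2) : restr (y K i) = Polynomial.C (y K i) := by
  conv_lhs => rw [y, restr, aeval_X]
  rfl

theorem kill_x_zero : kill (x K 0) = 0 := by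
  conv_lhs => rw [x, kill, aeval_X]
  rfl

theorem kill_x_one : kill (x K 1) = x K 1 := by
  conv_lhs => rw [x, kill, aeval_X]
  rfl

theorem kill_y (i : Fin 2) : kill (y K i) = y K i := by
  conv_lhs => rw [y, kill, aeval_X]
  rfl

theorem eval_restr (p : R K) : (restr p).eval (x K 1) = kill p := by
  have : ((Polynomial.aeval (R := R K) (x K 1)).restrictScalars K).comp restr = kill := by
    apply algHom_ext_xy <;> intro i <;> fin_cases i <;>
      simp [restr_x_zero, restr_x_one, restr_y, kill_x_zero, kill_x_one, kill_y]
  exact DFunLike.congr_fun this p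

theorem map_kill_expandX (p : R K) :
    (expandX p).map (kill : R K →ₐ[K] R K).toRingHom = restr p := by
  have : (Polynomial.mapAlgHom (kill : R K →ₐ[K] R K)).comp expandX = restr := by
    apply algHom_ext_xy <;> intro i <;> fin_cases i <;>
      simp [expandX_x_zero, expandX_x_one, expandX_y, restr_x_zero, restr_x_one, restr_y,
        kill_x_zero, kill_y]
  exact DFunLike.congr_fun this p

theorem x_zero_dvd_of_restr_eq_zero {p : R K} (h : restr p = 0) : x K 0 ∣ p := by
  have h1 : kill p = 0 := by rw [← eval_restr, h, Polynomial.eval_zero]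
  have h2 : (Ideal.Quotient.mkₐ K (Ideal.span {x K 0})).comp kill =
      Ideal.Quotient.mkₐ K (Ideal.span {x K 0}) := by
    apply algHom_ext_xy <;> intro i <;> fin_cases i
    · simp only [Fin.zero_eta, AlgHom.comp_apply, kill_x_zero, map_zero]
      exact (Ideal.Quotient.eq_zero_iff_mem.2 (Ideal.mem_span_singleton_self _)).symm
    · simp [kill_x_one]
    · simp [kill_y]
    · simp [kill_y]
  have h3 := DFunLike.congr_fun h2 p
  rw [AlgHom.comp_apply, h1, map_zero] at h3
  exact Ideal.mem_span_singleton.1 (Ideal.Quotient.eq_zero_iff_mem.1 h3.symm)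

theorem restr_sub_diagonal (a b : K) (p : R K) :
    restr (sub !![a, 0; 0, b] 1 p) =
      (restr p).comp (Polynomial.C (C b) * Polynomial.X) := by
  have : restr.comp (sub !![a, 0; 0, b] 1) = ((Polynomial.aeval (R := R K)
      (Polynomial.C (C b) * Polynomial.X : Polynomial (R K))).restrictScalars K).comp restr := by
    apply algHom_ext_xy <;> intro i <;> fin_cases i <;>
      simp [sub_x, sub_y, restr_x_zero, restr_x_one, restr_y, Polynomial.aeval_C,
        Polynomial.algebraMap_apply]
  exact DFunLike.congr_fun this p

theorem restr_sub_right (H : Matrix (Fin 2) (Fin 2) K) (p : R K) :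
    restr (sub 1 H p) = (restr p).map (sub 1 H).toRingHom := by
  have : restr.comp (sub 1 H) = (Polynomial.mapAlgHom (sub 1 H)).comp restr := by
    apply algHom_ext_xy <;> intro i <;> fin_cases i <;>
      simp [sub_x, sub_y, restr_x_zero, restr_x_one, restr_y]
  exact DFunLike.congr_fun this p

theorem expandX_sub_transvection (a : K) (p : R K) :
    expandX (sub !![1, 0; a, 1] 1 p) =
      (expandX p).comp (Polynomial.X + Polynomial.C (a • x K 0)) := by
  have : expandX.comp (sub !![1, 0; a, 1] 1) = ((Polynomial.aeval (R := R K)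
      (Polynomial.X + Polynomial.C (a • x K 0) : Polynomial (R K))).restrictScalars K).comp
        expandX := by
    apply algHom_ext_xy <;> intro i <;> fin_cases i <;>
      simp [sub_x, sub_y, expandX_x_zero, expandX_x_one, expandX_y, Polynomial.aeval_C,
        Polynomial.algebraMap_apply, smul_eq_C_mul, add_comm]
  exact DFunLike.congr_fun this p

theorem sub_coeff_restr {p : R K} (hp : p ∈ invSLSL K) {H : Matrix (Fin 2) (Fin 2) K}
    (hH : H.det = 1) (n : ℕ) : sub 1 H ((restr p).coeff n) = (restr p).coeff n := by
  have h1 := restr_sub_right H p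
  rw [hp 1 H Matrix.det_one hH] at h1
  have h2 := congrArg (fun f => f.coeff n) h1
  simp only [Polynomial.coeff_map] at h2
  exact h2.symm

variable [Fintype K]

/-- The unipotent elements force the exponents to be divisible by `q`, the torus by `q - 1`. -/
theorem dvd_of_coeff_restr_ne_zero {p : R K} (hp : p ∈ invSLSL K) {n : ℕ}
    (hn : (restr p).coeff n ≠ 0) : q K * (q K - 1) ∣ n := by
  have hq := two_le_q (K := K)
  have hcop : (q K).Coprime (q K - 1) := by
    obtain ⟨m, hm⟩ : ∃ m, q K = m + 1 := ⟨q K - 1, by omega⟩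
    rw [hm, Nat.add_sub_cancel]
    simp
  refine hcop.mul_dvd_of_dvd_of_dvd ?_ ?_
  · obtain ⟨g, hg⟩ := exists_eq_comp_of_translation (K := K) (x_ne_zero (K := K) 0) (expandX p)
      (fun a => by rw [← expandX_sub_transvection, hp _ _ (by simp [Matrix.det_fin_two]) (by simp)])
    have h1 := map_kill_expandX p
    rw [hg, Polynomial.map_comp, Polynomial.map_prod] at h1
    have h2 : ∏ a : K, (Polynomial.X - Polynomial.C (a • x K 0)).map
        (kill : R K →ₐ[K] R K).toRingHom = Polynomial.X ^ q K := by
      rw [Finset.prod_congr rfl (g := fun _ => Polynomial.X) fun a _ => by simp [kill_x_zero]]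
      simp
    rw [h2, ← Polynomial.expand_eq_comp_X_pow] at h1
    by_contra hdvd
    rw [← h1, Polynomial.coeff_expand (by omega), if_neg hdvd] at hn
    exact hn rfl
  · rw [← FiniteField.forall_pow_eq_one_iff K]
    intro u
    have h1 := restr_sub_diagonal (↑u⁻¹ : K) (u : K) p
    rw [hp _ _ (by simp [Matrix.det_fin_two]) (by simp)] at h1
    have h2 := congrArg (fun f => f.coeff n) h1
    simp only [Polynomial.comp_C_mul_X_coeff] at h2
    have h3 : (C (u : K) : R K) ^ n = 1 := by
      apply mul_left_cancel₀ hn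
      rw [mul_one]; exact h2.symm
    rw [← C_pow, ← C_1] at h3
    ext
    rw [Units.val_pow_eq_pow_val, Units.val_one]
    exact C_injective _ _ h3

end Restriction

/-! ### Polynomials vanishing at all linear forms -/

noncomputable section Forms

variable {K : Type*} [Field K]

theorem linearForm_injective :
    Function.Injective fun v : K × K => C v.1 * y K 0 + C v.2 * y K 1 := by
  rintro ⟨a, b⟩ ⟨a', b'⟩ h
  have h1 := congrArg (aeval (Sum.elim (fun _ : Fin 2 => (0 : K)) ![1, 0])) h
  have h2 := congrArg (aeval (Sum.elim (fun _ : Fin 2 => (0 : K)) ![0, 1])) h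
  simp [y] at h1 h2
  rw [h1, h2]

theorem exists_sub_y_one_eq {v : K × K} (hv : v ≠ 0) : ∃ H : Matrix (Fin 2) (Fin 2) K,
    H.det = 1 ∧ sub 1 H (y K 1) = C v.1 * y K 0 + C v.2 * y K 1 := by
  obtain ⟨a, b⟩ := v
  by_cases hb : b = 0
  · subst hb
    have ha : a ≠ 0 := by rintro rfl; exact hv rfl
    exact ⟨!![0, -a⁻¹; a, 0], by simp [Matrix.det_fin_two, ha], by simp [sub_y]⟩
  · exact ⟨!![b⁻¹, 0; a, b], by simp [Matrix.det_fin_two, hb], by simp [sub_y]⟩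

variable [Fintype K]

/-- The nonzero linear forms in the `y`'s are the roots of the Dickson polynomial
`T ^ (q² - 1) - h₀ T ^ (q - 1) + d* ^ (q - 1)`. -/
theorem y_pow_relation {H : Matrix (Fin 2) (Fin 2) K} (hH : H.det = 1) :
    sub 1 H (y K 1) ^ (q K * q K - 1) - h K 0 * sub 1 H (y K 1) ^ (q K - 1) +
      dStar K ^ (q K - 1) = 0 := by
  have hq := two_le_q (K := K)
  have hqq : 1 ≤ q K * q K := by nlinarith
  have h0 : y K 1 ^ (q K * q K - 1) - h K 0 * y K 1 ^ (q K - 1) + dStar K ^ (q K - 1) = 0 := by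
    apply mul_left_cancel₀ (mul_ne_zero (dStar_ne_zero (K := K)) (y_ne_zero (K := K) 1))
    have e1 : y K 1 * y K 1 ^ (q K * q K - 1) = (y K 1 ^ q K) ^ q K := by
      rw [← pow_succ', Nat.sub_add_cancel hqq, pow_mul]
    have e2 : y K 1 * y K 1 ^ (q K - 1) = y K 1 ^ q K := by
      rw [← pow_succ', Nat.sub_add_cancel (by omega)]
    have e3 : dStar K * dStar K ^ (q K - 1) = dStar K ^ q K := by
      rw [← pow_succ', Nat.sub_add_cancel (by omega)]
    have e4 : dStar K * (y K 1 ^ q K) ^ q K - d₂Star K * y K 1 ^ q K + dStar K ^ q K * y K 1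
        = 0 := by
      simp only [dStar_eq, d₂Star, sub_pow_q, mul_pow]
      ring
    linear_combination e4 + dStar K * e1 - dStar K * h K 0 * e2 + y K 1 * e3
      - y K 1 ^ q K * dStar_mul_h_zero K
  have h1 := congrArg (sub 1 H) h0
  simpa only [map_add, map_sub, map_mul, map_pow, map_zero, h_zero_mem K 1 H Matrix.det_one hH,
    dStar_mem 1 H Matrix.det_one hH] using h1

/-- A polynomial vanishing at all nonzero linear forms is a multiple of the Dickson polynomial. If
its degree is small, its lowest and highest coefficients are proportional, so that missing
exponents force it to vanish. -/
theorem eq_zero_of_eval_forms {Q : Polynomial (R K)}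
    (hdeg : Q.natDegree < q K * q K - 1 + (q K - 1))
    (hroot : ∀ H : Matrix (Fin 2) (Fin 2) K, H.det = 1 → Q.eval (sub 1 H (y K 1)) = 0)
    (hgap : ∀ t < q K - 1, Q.coeff t = 0 ∨ Q.coeff (q K * q K - 1 + t) = 0) : Q = 0 := by
  classical
  have hq := two_le_q (K := K)
  have hqq : q K * 2 ≤ q K * q K := Nat.mul_le_mul_left _ hq
  set P : Polynomial (R K) := Polynomial.X ^ (q K * q K - 1) -
    (Polynomial.C (h K 0) * Polynomial.X ^ (q K - 1) - Polynomial.C (dStar K ^ (q K - 1))) with hP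
  have hlow : (Polynomial.C (h K 0) * Polynomial.X ^ (q K - 1) -
      Polynomial.C (dStar K ^ (q K - 1))).degree < ((q K * q K - 1 : ℕ) : WithBot ℕ) := by
    refine (Polynomial.degree_sub_le _ _).trans_lt (max_lt ?_ ?_)
    · refine (Polynomial.degree_C_mul_X_pow_le _ _).trans_lt ?_
      exact_mod_cast (show q K - 1 < q K * q K - 1 by omega)
    · refine Polynomial.degree_C_le.trans_lt ?_
      exact_mod_cast (show 0 < q K * q K - 1 by omega)
  have hmon : P.Monic := Polynomial.monic_X_pow_sub hlow
  have hPdeg : P.degree = ((q K * q K - 1 : ℕ) : WithBot ℕ) := by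
    rw [hP, Polynomial.degree_sub_eq_left_of_degree_lt] <;> rw [Polynomial.degree_X_pow]
    exact hlow
  have hProot : ∀ H : Matrix (Fin 2) (Fin 2) K, H.det = 1 → P.eval (sub 1 H (y K 1)) = 0 := by
    intro H hH
    have := y_pow_relation hH
    simp only [hP, Polynomial.eval_sub, Polynomial.eval_mul, Polynomial.eval_pow,
      Polynomial.eval_X, Polynomial.eval_C]
    linear_combination this
  have hmod : Q %ₘ P = 0 := by
    refine Polynomial.eq_zero_of_degree_lt_of_eval_finset_eq_zero
      ((Finset.univ.erase (0 : K × K)).image fun v => C v.1 * y K 0 + C v.2 * y K 1) ?_ ?_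
    · rw [Finset.card_image_of_injective _ linearForm_injective,
        Finset.card_erase_of_mem (Finset.mem_univ _), Finset.card_univ, Fintype.card_prod]
      exact (Polynomial.degree_modByMonic_lt Q hmon).trans_eq hPdeg
    · intro t ht
      obtain ⟨v, hv, rfl⟩ := Finset.mem_image.1 ht
      obtain ⟨H, hH, hv'⟩ := exists_sub_y_one_eq (Finset.ne_of_mem_erase hv)
      rw [← hv']
      have h1 := congrArg (Polynomial.eval (sub 1 H (y K 1))) (Polynomial.modByMonic_add_div Q P)
      rw [Polynomial.eval_add, Polynomial.eval_mul, hProot H hH, hroot H hH, zero_mul,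
        add_zero] at h1
      exact h1
  obtain ⟨W, hW⟩ := (Polynomial.modByMonic_eq_zero_iff_dvd hmon).1 hmod
  by_cases hW0 : W = 0
  · rw [hW, hW0, mul_zero]
  have hWdeg : W.natDegree < q K - 1 := by
    have h1 : Q.natDegree = P.natDegree + W.natDegree := by rw [hW, hmon.natDegree_mul' hW0]
    rw [Polynomial.natDegree_eq_of_degree_eq_some hPdeg] at h1
    omega
  have hcoeff : ∀ n, Q.coeff n = (if q K * q K - 1 ≤ n then W.coeff (n - (q K * q K - 1)) else 0) -
      h K 0 * (if q K - 1 ≤ n then W.coeff (n - (q K - 1)) else 0) +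
      dStar K ^ (q K - 1) * W.coeff n := by
    intro n
    have : Q = Polynomial.X ^ (q K * q K - 1) * W - Polynomial.C (h K 0) *
        (Polynomial.X ^ (q K - 1) * W) + Polynomial.C (dStar K ^ (q K - 1)) * W := by
      rw [hW, hP]; ring
    rw [this]
    simp only [Polynomial.coeff_add, Polynomial.coeff_sub, Polynomial.coeff_C_mul,
      Polynomial.coeff_X_pow_mul']
  exfalso
  apply hW0
  ext1 t
  rw [Polynomial.coeff_zero]
  rcases Nat.lt_or_ge t (q K - 1) with ht | ht
  · rcases hgap t ht with h1 | h1
    · rw [hcoeff, if_neg (by omega), if_neg (by omega)] at h1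
      simpa [dStar_ne_zero] using h1
    · rw [hcoeff, if_pos (by omega), if_pos (by omega), Nat.add_sub_cancel_left,
        Polynomial.coeff_eq_zero_of_natDegree_lt (p := W) (n := q K * q K - 1 + t - (q K - 1))
          (by omega),
        Polynomial.coeff_eq_zero_of_natDegree_lt (p := W) (n := q K * q K - 1 + t)
          (by omega)] at h1
      simpa using h1
  · exact Polynomial.coeff_eq_zero_of_natDegree_lt (by omega)

end Forms

/-! ### Independence and saturation of the span -/

noncomputable section Independence

variable {K : Type*} [Field K] [Fintype K]

theorem restr_d : restr (d K) = 0 := by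
  have hq := two_le_q (K := K)
  simp only [d_eq, map_sub, map_mul, map_pow, restr_x_zero]
  rw [zero_pow (by omega)]; ring

theorem restr_dStar : restr (dStar K) = Polynomial.C (dStar K) := by
  simp only [dStar_eq, map_sub, map_mul, map_pow, restr_y]

theorem restr_u₀ {K : Type*} [Field K] : restr (u₀ K) = Polynomial.X * Polynomial.C (y K 1) := by
  simp only [u₀, map_add, map_mul, restr_x_zero, restr_x_one, restr_y, zero_mul, zero_add]

theorem restr_u₁ : restr (u₁ K) = Polynomial.X ^ q K * Polynomial.C (y K 1) := by
  have hq := two_le_q (K := K)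
  simp only [u₁, map_add, map_mul, map_pow, restr_x_zero, restr_x_one, restr_y]
  rw [zero_pow (by omega)]; ring

theorem restr_u₁Star : restr (u₁Star K) = Polynomial.X * Polynomial.C (y K 1) ^ q K := by
  simp only [u₁Star, map_add, map_mul, map_pow, restr_x_zero, restr_x_one, restr_y, zero_mul,
    zero_add]

/-- Since `d` vanishes on the line `x 0 = 0`, only one summand of `hNum` survives there. -/
theorem restr_h {s : ℕ} (hs : s + 2 ≤ q K) :
    Polynomial.C (y K 1) ^ (q K - 2 - s) * restr (h K (s + 1)) =
      Polynomial.C (dStar K) ^ (q K - 2 - s) * Polynomial.X ^ (q K * (s + 1)) := by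
  have hy : (Polynomial.C (y K 1) : Polynomial (R K)) ≠ 0 := by
    simpa using y_ne_zero (K := K) 1
  have h1 := congrArg restr (u₀_pow_mul_h K (s := s + 1) (by omega))
  rw [hNum] at h1
  simp only [map_mul, map_pow, map_add, restr_u₀, restr_u₁, restr_dStar, restr_d,
    zero_pow (Nat.succ_ne_zero s), mul_zero, add_zero] at h1
  obtain ⟨n, hn⟩ : ∃ n, q K = s + 2 + n := ⟨q K - (s + 2), by omega⟩
  rw [show q K - (s + 1) - 1 = n by omega] at h1
  rw [show q K - 2 - s = n by omega]
  apply mul_left_cancel₀ (pow_ne_zero (s + 2) hy)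
  apply mul_left_cancel₀ (pow_ne_zero (q K) (Polynomial.X_ne_zero (R := R K)))
  have e : (Polynomial.C (y K 1) : Polynomial (R K)) ^ q K =
      Polynomial.C (y K 1) ^ (s + 2) * Polynomial.C (y K 1) ^ n := by rw [← pow_add, ← hn]
  rw [mul_pow, e] at h1
  linear_combination h1

/-- On the line `x 0 = 0` the generators are monomials in `x 1` and `y 1`, up to invariants. -/
theorem restr_gen (e : Idx K) :
    Polynomial.C (y K 1) ^ (q K - 2) * restr (gen K e) =
      Polynomial.C (dStar K) ^ dExp e * (Polynomial.X ^ xExp e * Polynomial.C (y K 1) ^ yExp e) := by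
  have hq := two_le_q (K := K)
  rcases e with ⟨i, j⟩ | ⟨i, j, k⟩ | ⟨s, k⟩
  · simp only [gen, xExp, yExp, dExp, map_mul, map_pow, restr_u₁, restr_u₁Star]
    ring
  · simp only [gen, xExp, yExp, dExp, map_mul, map_pow, restr_u₁, restr_u₁Star, restr_u₀]
    ring
  · have hs := s.2
    have h1 := restr_h (K := K) (s := s) (by omega)
    have e : (Polynomial.C (y K 1) : Polynomial (R K)) ^ (q K - 2) =
      Polynomial.C (y K 1) ^ (q K - 2 - s) * Polynomial.C (y K 1) ^ (s : ℕ) := by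
      rw [← pow_add, Nat.sub_add_cancel (by omega)]
    simp only [gen, xExp, yExp, dExp, map_mul, map_pow, restr_u₀]
    rw [e]
    linear_combination Polynomial.C (y K 1) ^ (s : ℕ) *
      (Polynomial.X * Polynomial.C (y K 1)) ^ (k : ℕ) * h1

/-- The generators are independent over the invariants on the line `x 0 = 0`. For a fixed power of
`x 1`, the substitutions of `SL₂` in the `y`'s turn a relation into a polynomial in one variable
that vanishes at all nonzero linear forms. -/
theorem restr_eq_zero_of_sum {p : Idx K → R K} (hp : ∀ e, p e ∈ invSLSL K)
    (hsum : restr (∑ e, p e * gen K e) = 0) (e : Idx K) : restr (p e) = 0 := by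
  classical
  have hq := two_le_q (K := K)
  have key : ∑ e, restr (p e) * (Polynomial.C (dStar K) ^ dExp e *
      (Polynomial.X ^ xExp e * Polynomial.C (y K 1) ^ yExp e)) = 0 := by
    have h1 := congrArg (fun f => Polynomial.C (y K 1) ^ (q K - 2) * f) hsum
    simp only [map_sum, map_mul, Finset.mul_sum, mul_zero] at h1
    rw [← h1]
    refine Finset.sum_congr rfl fun e _ => ?_
    rw [← restr_gen]; ring
  -- `b N e` is the coefficient of `x 1 ^ N` in the summand of index `e`, without the power of `y 1`
  let b : ℕ → Idx K → R K := fun N e =>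
    (if xExp e ≤ N then (restr (p e)).coeff (N - xExp e) else 0) * dStar K ^ dExp e
  have hbsum : ∀ N, ∑ e, b N e * y K 1 ^ yExp e = 0 := by
    intro N
    have h1 := congrArg (fun f => Polynomial.coeff f N) key
    simp only [Polynomial.finsetSum_coeff, Polynomial.coeff_zero] at h1
    rw [← h1]
    refine Finset.sum_congr rfl fun e _ => ?_
    rw [show restr (p e) * (Polynomial.C (dStar K) ^ dExp e *
      (Polynomial.X ^ xExp e * Polynomial.C (y K 1) ^ yExp e)) =
      restr (p e) * Polynomial.X ^ xExp e * Polynomial.C (dStar K ^ dExp e * y K 1 ^ yExp e) by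
        rw [Polynomial.C_mul, Polynomial.C_pow, Polynomial.C_pow]; ring,
      Polynomial.coeff_mul_C, Polynomial.coeff_mul_X_pow']
    simp only [b]
    ring
  have hbinv : ∀ N e (H : Matrix (Fin 2) (Fin 2) K), H.det = 1 → sub 1 H (b N e) = b N e := by
    intro N e H hH
    simp only [b, map_mul, map_pow, dStar_mem 1 H Matrix.det_one hH]
    split_ifs
    · rw [sub_coeff_restr (hp e) hH]
    · rw [map_zero]
  have hbmod : ∀ N e, b N e ≠ 0 → xExp e ≡ N [MOD q K * (q K - 1)] := by
    intro N e hb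
    simp only [b] at hb
    have h1 := left_ne_zero_of_mul hb
    split_ifs at h1 with h2
    · exact (Nat.modEq_iff_dvd' h2).2 (dvd_of_coeff_restr_ne_zero (hp e) h1)
    · exact absurd rfl h1
  have huniq : ∀ N e e', b N e ≠ 0 → b N e' ≠ 0 → yExp e ≡ yExp e' [MOD q K * q K - 1] →
      e = e' := fun N e e' h1 h2 h3 =>
    eq_of_exp_modEq ((hbmod N e h1).trans (hbmod N e' h2).symm) h3
  have hbzero : ∀ N e, b N e = 0 := by
    intro N
    let Q : Polynomial (R K) := ∑ e, Polynomial.C (b N e) * Polynomial.X ^ yExp e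
    have hQc : ∀ t, Q.coeff t = ∑ e, if t = yExp e then b N e else 0 := by
      intro t
      simp only [Q, Polynomial.finsetSum_coeff, Polynomial.coeff_C_mul_X_pow]
    have hQne : ∀ t, Q.coeff t ≠ 0 → ∃ e, yExp e = t ∧ b N e ≠ 0 := by
      intro t ht
      rw [hQc] at ht
      obtain ⟨e, -, he⟩ := Finset.exists_ne_zero_of_sum_ne_zero ht
      split_ifs at he with h1
      · exact ⟨e, h1.symm, he⟩
      · exact absurd rfl he
    have hQ : Q = 0 := by
      refine eq_zero_of_eval_forms ?_ ?_ ?_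
      · refine Nat.lt_of_le_of_lt (m := q K * q K - 1 + (q K - 1) - 1) ?_ (by omega)
        refine Polynomial.natDegree_sum_le_of_forall_le _ _ fun e _ => ?_
        refine (Polynomial.natDegree_C_mul_X_pow_le _ _).trans ?_
        have := yExp_lt e
        omega
      · intro H hH
        have h1 := congrArg (sub 1 H) (hbsum N)
        simp only [map_sum, map_mul, map_pow, hbinv _ _ H hH, map_zero] at h1
        simp only [Q, Polynomial.eval_finsetSum, Polynomial.eval_mul, Polynomial.eval_C,
          Polynomial.eval_pow, Polynomial.eval_X]
        exact h1
      · intro t _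
        by_contra! hne
        obtain ⟨e, he, hbe⟩ := hQne _ hne.1
        obtain ⟨e', he', hbe'⟩ := hQne _ hne.2
        have := huniq N e e' hbe hbe' (by rw [he, he']; simp [Nat.ModEq])
        rw [this, he'] at he
        have : q K * 2 ≤ q K * q K := Nat.mul_le_mul_left _ hq
        omega
    intro e
    by_contra hbe
    have h1 := hQc (yExp e)
    rw [hQ, Polynomial.coeff_zero, Finset.sum_eq_single e ?_ (by simp), if_pos rfl] at h1
    · exact hbe h1.symm
    · intro e' _ hne
      split_ifs with h2
      · by_contra h3
        exact hne (huniq N e' e h3 hbe (by rw [h2]))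
      · rfl
  ext1 n
  have h1 := hbzero (n + xExp e) e
  simp only [b, Nat.le_add_left, if_true, Nat.add_sub_cancel] at h1
  rw [Polynomial.coeff_zero]
  exact (mul_eq_zero.1 h1).resolve_right (pow_ne_zero _ dStar_ne_zero)

theorem mem_invSLSL_of_d_mul {p p' : R K} (hp : p ∈ invSLSL K) (h : p = d K * p') :
    p' ∈ invSLSL K := by
  intro G H hG hH
  apply mul_left_cancel₀ (d_ne_zero (K := K))
  conv_lhs => rw [← d_mem G H hG hH]
  rw [← map_mul, ← h, hp G H hG hH]

theorem exists_d_mul_of_restr_eq_zero {p : R K} (hp : p ∈ invSLSL K) (h : restr p = 0) :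
    ∃ p' ∈ invSLSL K, p = d K * p' := by
  obtain ⟨p', hp'⟩ := d_dvd hp (x_zero_dvd_of_restr_eq_zero h)
  exact ⟨p', mem_invSLSL_of_d_mul hp hp', hp'⟩

/-- The independence on the line `x 0 = 0` makes the span of the generators saturated with respect
to `d`. -/
theorem mem_genSpan_of_d_mul {f : R K} (hf : d K * f ∈ genSpan K) : f ∈ genSpan K := by
  obtain ⟨c, hc⟩ := (Submodule.mem_span_range_iff_exists_fun _).1 hf
  have hc' : ∑ e, (c e : R K) * gen K e = d K * f := hc
  have h1 := restr_eq_zero_of_sum (p := fun e => (c e : R K)) (fun e => (c e).2)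
    (by rw [hc', map_mul, restr_d, zero_mul])
  choose p hp hpc using fun e => exists_d_mul_of_restr_eq_zero (c e).2 (h1 e)
  have h2 : f = ∑ e, p e * gen K e := by
    apply mul_left_cancel₀ (d_ne_zero (K := K))
    rw [← hc', Finset.mul_sum]
    refine Finset.sum_congr rfl fun e _ => ?_
    rw [hpc, mul_assoc]
  rw [h2]
  exact sum_mem fun e _ => smul_mem_genSpan (hp e) (gen_mem_genSpan e)

/-- The generators span the invariants of the diagonal `SL₂`. -/
theorem mem_genSpan_of_invariant {f : R K} (hf : ∀ G H : Matrix (Fin 2) (Fin 2) K,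
    G.det = 1 → H * G.transpose = 1 → sub G H f = f) : f ∈ genSpan K := by
  obtain ⟨N, hN⟩ := exists_d_pow_mul_mem_genSpan hf
  induction N with
  | zero => simpa using hN
  | succ N ih =>
    rw [pow_succ', mul_assoc] at hN
    exact ih (mem_genSpan_of_d_mul hN)

/-- A relation between the generators would be divisible by every power of `d`. -/
theorem eq_zero_of_sum_gen {p : Idx K → R K} (hp : ∀ e, p e ∈ invSLSL K)
    (hsum : ∑ e, p e * gen K e = 0) (e : Idx K) : p e = 0 := by
  have hpow : ∀ N, ∀ p : Idx K → R K, (∀ e, p e ∈ invSLSL K) → ∑ e, p e * gen K e = 0 →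
      ∀ e, d K ^ N ∣ p e := by
    intro N
    induction N with
    | zero => intro p _ _ e; simp
    | succ N ih =>
      intro p hp hsum e
      have h1 := restr_eq_zero_of_sum hp (by rw [hsum, map_zero])
      choose p' hp' hpc using fun e => exists_d_mul_of_restr_eq_zero (hp e) (h1 e)
      rw [hpc e, pow_succ']
      refine mul_dvd_mul_left _ (ih p' hp' ?_ e)
      apply mul_left_cancel₀ (d_ne_zero (K := K))
      rw [mul_zero, ← hsum, Finset.mul_sum]
      refine Finset.sum_congr rfl fun e _ => ?_
      rw [hpc, mul_assoc]
  by_contra hne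
  have hunit : ¬ IsUnit (d K) := by
    intro hu
    rw [d_eq_prod, IsUnit.neg_iff] at hu
    exact (x_prime 0).not_isUnit (isUnit_of_mul_isUnit_left hu)
  obtain ⟨N, hN⟩ := FiniteMultiplicity.of_not_isUnit hunit hne
  exact hN (hpow _ p hp hsum e)

end Independence

/-! ### Decomposition of the invariants of `SL₂ × SL₂` by weights -/

noncomputable section Isotypic

variable {K : Type*} [Field K]

/-- On the invariants of `SL₂ × SL₂` a substitution acts through its two determinants. -/
theorem sub_eq_sub_of_det_eq {p : R K} (hp : p ∈ invSLSL K) {G H G' H' : Matrix (Fin 2) (Fin 2) K}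
    (hG : G.det ≠ 0) (hH : H.det ≠ 0) (hGG : G'.det = G.det) (hHH : H'.det = H.det) :
    sub G' H' p = sub G H p := by
  have hGi : G⁻¹ * G = 1 := Matrix.nonsing_inv_mul _ (isUnit_iff_ne_zero.2 hG)
  have hHi : H⁻¹ * H = 1 := Matrix.nonsing_inv_mul _ (isUnit_iff_ne_zero.2 hH)
  have h1 : sub (G' * G⁻¹) (H' * H⁻¹) p = p := by
    refine hp _ _ ?_ ?_
    · rw [Matrix.det_mul, hGG, ← Matrix.det_mul, mul_eq_one_comm.1 hGi, Matrix.det_one]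
    · rw [Matrix.det_mul, hHH, ← Matrix.det_mul, mul_eq_one_comm.1 hHi, Matrix.det_one]
  conv_rhs => rw [← h1]
  rw [sub_sub, mul_assoc, hGi, mul_assoc, hHi, mul_one, mul_one]

/-- The diagonal matrix with determinant `a` that fixes the second variable. -/
def diag (a : K) : Matrix (Fin 2) (Fin 2) K := !![a, 0; 0, 1]

@[simp] theorem det_diag (a : K) : (diag a).det = a := by simp [diag, Matrix.det_fin_two]

theorem diag_mul_transpose {a b : K} (h : b * a = 1) : diag b * (diag a).transpose = 1 := by
  ext i j
  fin_cases i <;> fin_cases j <;> simp [diag, Matrix.mul_apply, Fin.sum_univ_two, h]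

variable [Fintype K] [DecidableEq K]

/-- The component of weight `(b, c)` of an invariant of `SL₂ × SL₂`. -/
def isotypic (b c : ℕ) (p : R K) : R K :=
  ∑ a : Kˣ, ∑ a' : Kˣ, C ((↑a⁻¹ : K) ^ b * (↑a'⁻¹ : K) ^ c) * sub (diag (a : K)) (diag (a' : K)) p

theorem isSemi_isotypic {p : R K} (hp : p ∈ invSLSL K) (b c : ℕ) :
    IsSemi b c (isotypic b c p) := by
  intro G H hG hH
  let g : Kˣ := Units.mk0 _ hG
  let h : Kˣ := Units.mk0 _ hH
  have hg : G.det = (g : K) := rfl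
  have hh : H.det = (h : K) := rfl
  rw [isotypic, map_sum, Finset.mul_sum]
  refine Fintype.sum_equiv (Equiv.mulRight g) _ _ fun a => ?_
  rw [map_sum, Finset.mul_sum]
  refine Fintype.sum_equiv (Equiv.mulRight h) _ _ fun a' => ?_
  rw [map_mul, sub_C, sub_sub, Equiv.coe_mulRight, Equiv.coe_mulRight,
    sub_eq_sub_of_det_eq (G := diag ((a * g : Kˣ) : K)) (H := diag ((a' * h : Kˣ) : K)) hp
      (by rw [det_diag]; exact Units.ne_zero _) (by rw [det_diag]; exact Units.ne_zero _)
      (by simp [Matrix.det_mul, hg]) (by simp [Matrix.det_mul, hh]),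
    ← mul_assoc, ← C_mul, hg, hh]
  congr 2
  simp only [mul_inv, Units.val_mul, mul_pow]
  have e1 : (g : K) ^ b * (↑g⁻¹ : K) ^ b = 1 := by rw [← mul_pow, Units.mul_inv, one_pow]
  have e2 : (h : K) ^ c * (↑h⁻¹ : K) ^ c = 1 := by rw [← mul_pow, Units.mul_inv, one_pow]
  linear_combination (-(↑a⁻¹ : K) ^ b * (↑a'⁻¹ : K) ^ c) * ((h : K) ^ c * (↑h⁻¹ : K) ^ c * e1 + e2)

theorem sum_range_pow_units (u : Kˣ) :
    ∑ b ∈ Finset.range (q K - 1), (u : K) ^ b = if u = 1 then -1 else 0 := by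
  split_ifs with h
  · rw [h]
    simp only [Units.val_one, one_pow, Finset.sum_const, Finset.card_range, nsmul_eq_mul, mul_one]
    rw [Nat.cast_sub Fintype.card_pos, FiniteField.cast_card_eq_zero]
    simp
  · have h1 : (u : K) - 1 ≠ 0 := by
      rw [sub_ne_zero]
      exact fun h2 => h (Units.ext h2)
    apply mul_left_cancel₀ h1
    rw [mul_zero, mul_comm, geom_sum_mul, FiniteField.pow_card_sub_one_eq_one _ u.ne_zero, sub_self]

theorem sum_isotypic (p : R K) :
    ∑ b ∈ Finset.range (q K - 1), ∑ c ∈ Finset.range (q K - 1), isotypic b c p = p := by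
  have h1 : ∑ b ∈ Finset.range (q K - 1), ∑ c ∈ Finset.range (q K - 1), isotypic b c p =
      ∑ a : Kˣ, ∑ a' : Kˣ, C ((∑ b ∈ Finset.range (q K - 1), (↑a⁻¹ : K) ^ b) *
        ∑ c ∈ Finset.range (q K - 1), (↑a'⁻¹ : K) ^ c) * sub (diag (a : K)) (diag (a' : K)) p := by
    simp only [isotypic, map_sum, Finset.sum_mul, Finset.mul_sum]
    simp only [Finset.sum_comm (s := Finset.range (q K - 1)) (t := (Finset.univ : Finset Kˣ))]
    exact Finset.sum_congr rfl fun _ _ => Finset.sum_congr rfl fun _ _ => Finset.sum_comm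
  rw [h1]
  simp only [sum_range_pow_units, inv_eq_one]
  rw [Finset.sum_eq_single 1 (fun a _ ha => by simp [ha]) (by simp),
    Finset.sum_eq_single 1 (fun a _ ha => by simp [ha]) (by simp)]
  have : diag (1 : K) = 1 := by
    ext i j
    fin_cases i <;> fin_cases j <;> simp [diag]
  simp [this, sub_one]

end Isotypic

noncomputable section SemiInvariants

variable {K : Type*} [Field K] [Fintype K]

/-- The matrices `diag(a, 1)` act trivially on the line `x 0 = 0`, where a semi-invariant of
nontrivial weight must therefore vanish. -/
theorem IsSemi.exists_eq_d_mul {b c : ℕ} (hb : b + 1 < q K - 1) {p : R K}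
    (hp : IsSemi (b + 1) c p) : ∃ p', IsSemi b c p' ∧ p = d K * p' := by
  have hr : restr p = 0 := by
    have h1 : ¬ q K - 1 ∣ b + 1 := fun h => absurd (Nat.le_of_dvd (Nat.succ_pos b) h) (by omega)
    rw [← FiniteField.forall_pow_eq_one_iff K] at h1
    push Not at h1
    obtain ⟨a, ha⟩ := h1
    have h2 := restr_sub_diagonal (a : K) 1 p
    rw [hp _ _ (by simp [Matrix.det_fin_two]) (by simp)] at h2
    simp only [Matrix.det_fin_two_of, Matrix.det_one, one_pow, mul_one, mul_zero, sub_zero, map_mul,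
      map_one, one_mul, Polynomial.comp_X] at h2
    have h3 : (restr (C ((a : K) ^ (b + 1)) : R K) - 1) * restr p = 0 := by
      linear_combination h2
    refine (mul_eq_zero.1 h3).resolve_left fun h4 => ha ?_
    have h5 : restr (C ((a : K) ^ (b + 1)) : R K) = Polynomial.C (C ((a : K) ^ (b + 1))) :=
      restr.commutes _
    rw [h5, sub_eq_zero, ← Polynomial.C_1, Polynomial.C_inj, ← C_1] at h4
    ext
    rw [Units.val_pow_eq_pow_val, Units.val_one]
    exact C_injective _ _ h4
  obtain ⟨p', -, hp'⟩ := exists_d_mul_of_restr_eq_zero hp.mem_invSLSL hr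
  refine ⟨p', fun G H hG hH => ?_, hp'⟩
  have h1 := hp G H hG hH
  have h2 : sub G H (d K) = C G.det * d K := by simpa using isSemi_d G H hG hH
  rw [hp', map_mul, h2] at h1
  apply mul_left_cancel₀ (mul_ne_zero ((map_ne_zero_iff C (C_injective _ _)).2 hG)
    (d_ne_zero (K := K)))
  rw [h1]
  simp only [map_mul, map_pow]
  ring

theorem IsSemi.exists_eq_d_pow_mul {b c : ℕ} (hb : b < q K - 1) {p : R K}
    (hp : IsSemi b c p) : ∃ p', IsSemi 0 c p' ∧ p = d K ^ b * p' := by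
  induction b generalizing p with
  | zero => exact ⟨p, hp, by simp⟩
  | succ b ih =>
    obtain ⟨p₁, h1, rfl⟩ := hp.exists_eq_d_mul hb
    obtain ⟨p₂, h2, rfl⟩ := ih (by omega) h1
    exact ⟨p₂, h2, by ring⟩

theorem IsSemi.exists_eq_dStar_pow_mul {b c : ℕ} (hc : c < q K - 1) {p : R K}
    (hp : IsSemi b c p) : ∃ p', IsSemi b 0 p' ∧ p = dStar K ^ c * p' := by
  obtain ⟨p', h1, h2⟩ := hp.swap.exists_eq_d_pow_mul hc
  refine ⟨(-1) ^ c * VectorCovector.swap K p', fun G H hG hH => ?_, ?_⟩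
  · rw [map_mul, map_pow, map_neg, map_one, h1.swap G H hG hH]
    ring
  · rw [← swap_swap p, h2, map_mul, map_pow, swap_d, neg_pow]
    ring

theorem exists_isotypic_eq [DecidableEq K] {p : R K} (hp : p ∈ invSLSL K) {b c : ℕ}
    (hb : b < q K - 1) (hc : c < q K - 1) :
    ∃ p' ∈ invGLGL K, isotypic b c p = p' * (dStar K ^ c * d K ^ b) := by
  obtain ⟨p₁, h1, h2⟩ := (isSemi_isotypic hp b c).exists_eq_d_pow_mul hb
  obtain ⟨p₂, h3, h4⟩ := h1.exists_eq_dStar_pow_mul hc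
  exact ⟨p₂, mem_invGLGL_iff_isSemi.2 h3, by rw [h2, h4]; ring⟩

end SemiInvariants

/-! ### The basis over the invariants of `GL₂ × GL₂` -/

noncomputable section ModuleBasis

variable {K : Type*} [Field K] [Fintype K]

/-- The weight of a generator under the determinant. -/
def wt : Idx K → ℕ
  | .inl _ => 0
  | .inr (.inl _) => 0
  | .inr (.inr (s, _)) => s + 1

theorem sub_gen {G H : Matrix (Fin 2) (Fin 2) K} (hGH : H * G.transpose = 1) (e : Idx K) :
    sub G H (gen K e) = C (G.det ^ wt e) * gen K e := by
  rcases e with ⟨i, j⟩ | ⟨i, j, k⟩ | ⟨s, k⟩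
  · simp [gen, wt, sub_u₁ hGH, sub_u₁Star hGH]
  · simp [gen, wt, sub_u₁ hGH, sub_u₁Star hGH, sub_u₀ hGH]
  · have hs := s.2
    simp only [gen, wt, map_mul, map_pow, sub_u₀ hGH, sub_h K hGH (s := s + 1) (by omega)]
    ring

/-- The parametrization of the set `D`. -/
def basisElem (i : Idx K × Fin (q K - 1)) : R K :=
  gen K i.1 * (dStar K ^ ((i.2 + wt i.1) % (q K - 1)) * d K ^ (i.2 : ℕ))

theorem basisElem_mem_invGL (i : Idx K × Fin (q K - 1)) : basisElem i ∈ invGL K := by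
  obtain ⟨e, b⟩ := i
  rw [mem_invGL_iff_sub]
  intro G H hGH
  have hdet : H.det * G.det = 1 := by
    rw [← Matrix.det_transpose G, ← Matrix.det_mul, hGH, Matrix.det_one]
  have hG : G.det ≠ 0 := right_ne_zero_of_mul_eq_one hdet
  have hH : H.det ≠ 0 := left_ne_zero_of_mul_eq_one hdet
  have hd : sub G H (d K) = C G.det * d K := by simpa using isSemi_d G H hG hH
  have hds : sub G H (dStar K) = C H.det * dStar K := by simpa using isSemi_dStar G H hG hH
  have e1 : G.det ^ wt e * (H.det ^ ((b + wt e) % (q K - 1)) * G.det ^ (b : ℕ)) = 1 := by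
    have h1 : G.det ^ (b + wt e : ℕ) = G.det ^ ((b + wt e) % (q K - 1)) := by
      conv_lhs => rw [← Nat.div_add_mod (b + wt e : ℕ) (q K - 1)]
      rw [pow_add, pow_mul, FiniteField.pow_card_sub_one_eq_one _ hG, one_pow, one_mul]
    calc _ = H.det ^ ((b + wt e) % (q K - 1)) * G.det ^ (b + wt e : ℕ) := by
          rw [pow_add]; ring
      _ = 1 := by rw [h1, ← mul_pow, hdet, one_pow]
  have e2 := congrArg (C : K → R K) e1
  simp only [map_mul, map_pow, map_one] at e2
  simp only [basisElem, map_mul, map_pow, sub_gen hGH, hd, hds, mul_pow]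
  linear_combination (gen K e * (dStar K ^ ((b + wt e) % (q K - 1)) * d K ^ (b : ℕ))) * e2

/-- The characters `a ↦ a ^ b` of `Kˣ`, for `b < q - 1`, are independent over the polynomials. -/
theorem eq_zero_of_forall_sum_pow {z : Fin (q K - 1) → R K}
    (hz : ∀ a : Kˣ, ∑ b : Fin (q K - 1), C ((a : K) ^ (b : ℕ)) * z b = 0) (b : Fin (q K - 1)) : z b = 0 := by
  classical
  have h1 : ∑ a : Kˣ, C ((a : K) ^ (q K - 1 - b)) * ∑ b' : Fin (q K - 1), C ((a : K) ^ (b' : ℕ)) * z b' = 0 :=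
    Finset.sum_eq_zero fun a _ => by rw [hz, mul_zero]
  have h2 : ∑ a : Kˣ, C ((a : K) ^ (q K - 1 - b)) * ∑ b' : Fin (q K - 1), C ((a : K) ^ (b' : ℕ)) * z b' =
      ∑ b' : Fin (q K - 1), C (∑ a : Kˣ, (a : K) ^ (q K - 1 - b + b' : ℕ)) * z b' := by
    simp only [Finset.mul_sum, map_sum, Finset.sum_mul]
    rw [Finset.sum_comm]
    refine Finset.sum_congr rfl fun b' _ => Finset.sum_congr rfl fun a _ => ?_
    rw [pow_add, C_mul]; ring
  rw [h2, Finset.sum_eq_single b] at h1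
  · rw [FiniteField.sum_pow_units, if_pos (by rw [Nat.sub_add_cancel b.2.le])] at h1
    simpa using h1
  · intro b' _ hne
    rw [FiniteField.sum_pow_units, if_neg, C_0, zero_mul]
    intro hdvd
    apply hne
    have h3 : (b : ℕ) ≡ b' [MOD q K - 1] := by
      have h4 : (q K - 1 - b + b) ≡ (q K - 1 - b + b') [MOD q K - 1] := by
        rw [Nat.sub_add_cancel b.2.le]
        exact ((Nat.modEq_zero_iff_dvd.2 dvd_rfl).trans (Nat.modEq_zero_iff_dvd.2 hdvd).symm)
      exact Nat.ModEq.add_left_cancel' _ h4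
    exact Fin.ext (h3.eq_of_lt_of_lt b.2 b'.2).symm
  · simp

theorem eq_zero_of_sum_basisElem {p : Idx K × Fin (q K - 1) → R K} (hp : ∀ i, p i ∈ invGLGL K)
    (hsum : ∑ i, p i * basisElem i = 0) (i : Idx K × Fin (q K - 1)) : p i = 0 := by
  obtain ⟨e, b⟩ := i
  let z : Idx K → Fin (q K - 1) → R K := fun e b =>
    p (e, b) * (dStar K ^ ((b + wt e) % (q K - 1)) * d K ^ (b : ℕ))
  have hpS : ∀ i, p i ∈ invSLSL K := fun i => (mem_invGLGL_iff_isSemi.1 (hp i)).mem_invSLSL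
  have h1 : ∀ e, ∑ b, z e b = 0 := by
    refine eq_zero_of_sum_gen (p := fun e => ∑ b, z e b) (fun e => sum_mem fun b _ => mul_mem (hpS _)
      (mul_mem (pow_mem dStar_mem _) (pow_mem d_mem _))) ?_
    rw [← hsum, Fintype.sum_prod_type]
    refine Finset.sum_congr rfl fun e _ => ?_
    rw [Finset.sum_mul]
    refine Finset.sum_congr rfl fun b _ => ?_
    simp only [z, basisElem]
    ring
  have h2 : z e b = 0 := by
    refine eq_zero_of_forall_sum_pow (fun a => ?_) b
    have h3 := congrArg (sub (diag (a : K)) 1) (h1 e)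
    rw [map_zero, map_sum] at h3
    rw [← h3]
    refine Finset.sum_congr rfl fun b _ => ?_
    have hdet : (diag (a : K)).det ≠ 0 := by rw [det_diag]; exact a.ne_zero
    have hdet' : (1 : Matrix (Fin 2) (Fin 2) K).det ≠ 0 := by simp
    simp only [z, map_mul, map_pow, mem_invGLGL_iff_isSemi.1 (hp _) _ _ hdet hdet',
      isSemi_d _ _ hdet hdet', isSemi_dStar _ _ hdet hdet', det_diag, Matrix.det_one,
      pow_zero, pow_one, map_one, mul_one, one_mul, mul_pow]
    ring
  exact (mul_eq_zero.1 h2).resolve_right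
    (mul_ne_zero (pow_ne_zero _ dStar_ne_zero) (pow_ne_zero _ d_ne_zero))

/-- Averaging over the determinant selects, among the products of the generators with powers of `d`
and `d*`, those that are invariant. -/
theorem mem_span_basisElem {f : R K} (hf : f ∈ invGL K) :
    f ∈ Submodule.span (invGLGL K) (Set.range (basisElem (K := K))) := by
  classical
  have hq := two_le_q (K := K)
  rw [mem_invGL_iff_sub] at hf
  set V := Submodule.span (invGLGL K) (Set.range (basisElem (K := K))) with hV
  let L : R K → R K := fun f => ∑ a : Kˣ, sub (diag (a : K)) (diag (↑a⁻¹ : K)) f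
  have hdiag : ∀ a : Kˣ, diag (↑a⁻¹ : K) * (diag (a : K)).transpose = 1 :=
    fun a => diag_mul_transpose (by simp)
  have hLf : L f = -f := by
    have h1 : L f = C (∑ a : Kˣ, (a : K) ^ 0) * f := by
      simp only [L, map_sum, Finset.sum_mul]
      exact Finset.sum_congr rfl fun a _ => by rw [hf _ _ (hdiag a)]; simp
    rw [h1, FiniteField.sum_pow_units, if_pos (dvd_zero _)]
    simp
  have hLsum : ∀ {ι : Type} (s : Finset ι) (g : ι → R K), L (∑ i ∈ s, g i) = ∑ i ∈ s, L (g i) := by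
    intro ι s g
    simp only [L, map_sum]
    exact Finset.sum_comm
  have hL : ∀ p ∈ invGLGL K, ∀ b c e, b < q K - 1 → c < q K - 1 →
      L (p * (dStar K ^ c * d K ^ b) * gen K e) ∈ V := by
    intro p hp b c e hb hc
    have h1 : L (p * (dStar K ^ c * d K ^ b) * gen K e) =
        C (∑ a : Kˣ, (a : K) ^ (b + wt e + (q K - 1 - c))) *
          (p * (dStar K ^ c * d K ^ b) * gen K e) := by
      simp only [L, map_sum, Finset.sum_mul]
      refine Finset.sum_congr rfl fun a _ => ?_
      have hdet : (diag (a : K)).det ≠ 0 := by rw [det_diag]; exact a.ne_zero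
      have hdet' : (diag (↑a⁻¹ : K)).det ≠ 0 := by rw [det_diag]; exact Units.ne_zero _
      have e1 : (↑a⁻¹ : K) ^ c = (a : K) ^ (q K - 1 - c) := by
        have h2 : (↑a⁻¹ : K) ^ c * (a : K) ^ c = 1 := by rw [← mul_pow, Units.inv_mul, one_pow]
        have h3 : (a : K) ^ (q K - 1 - c) * (a : K) ^ c = 1 := by
          rw [← pow_add, Nat.sub_add_cancel hc.le]
          exact FiniteField.pow_card_sub_one_eq_one _ a.ne_zero
        exact mul_right_cancel₀ (pow_ne_zero c a.ne_zero) (h2.trans h3.symm)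
      have e2 := congrArg (C : K → R K) e1
      rw [C_pow, C_pow] at e2
      simp only [map_mul, map_pow, mem_invGLGL_iff_isSemi.1 hp _ _ hdet hdet',
        isSemi_d _ _ hdet hdet', isSemi_dStar _ _ hdet hdet', sub_gen (hdiag a), det_diag,
        pow_zero, pow_one, map_one, mul_one, one_mul, mul_pow, e2, pow_add]
      ring
    rw [h1, FiniteField.sum_pow_units]
    split_ifs with h2
    · have h3 : (b + wt e) % (q K - 1) = c := by
        have h4 : (q K - 1 - c + c) ≡ (q K - 1 - c + (b + wt e)) [MOD q K - 1] := by
          rw [Nat.sub_add_cancel hc.le, add_comm _ (b + wt e)]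
          exact ((Nat.modEq_zero_iff_dvd.2 dvd_rfl).trans (Nat.modEq_zero_iff_dvd.2 h2).symm)
        have h5 := Nat.ModEq.add_left_cancel' _ h4
        rw [← Nat.mod_eq_of_lt hc]
        exact h5.symm
      have h6 : C (-1 : K) * (p * (dStar K ^ c * d K ^ b) * gen K e) =
          -p * basisElem (e, ⟨b, hb⟩) := by
        simp only [basisElem, h3, C_neg, C_1]
        ring
      rw [h6]
      exact V.smul_mem (⟨-p, neg_mem hp⟩ : invGLGL K) (Submodule.subset_span ⟨_, rfl⟩)
    · rw [C_0, zero_mul]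
      exact zero_mem _
  obtain ⟨c, hc⟩ := (Submodule.mem_span_range_iff_exists_fun _).1
    (mem_genSpan_of_invariant fun G H _ hGH => hf G H hGH)
  have hc' : ∑ e, (c e : R K) * gen K e = f := hc
  have hfV : L f ∈ V := by
    rw [← hc', hLsum]
    refine sum_mem fun e _ => ?_
    rw [← sum_isotypic (c e : R K), Finset.sum_mul, hLsum]
    refine sum_mem fun b hb => ?_
    rw [Finset.sum_mul, hLsum]
    refine sum_mem fun b' hb' => ?_
    obtain ⟨p', hp', hpe⟩ := exists_isotypic_eq (c e).2 (Finset.mem_range.1 hb)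
      (Finset.mem_range.1 hb')
    rw [hpe]
    exact hL p' hp' _ _ _ (Finset.mem_range.1 hb) (Finset.mem_range.1 hb')
  rw [hLf] at hfV
  exact neg_mem_iff.1 hfV

theorem range_basisElem : Set.range (basisElem (K := K)) = D K := by
  have hq := two_le_q (K := K)
  ext f
  constructor
  · rintro ⟨⟨⟨i, j⟩ | ⟨i, j, k⟩ | ⟨s, k⟩, b⟩, rfl⟩
    · have hb := b.2
      refine Or.inl (Or.inl ⟨i, j, b, by omega, by omega, by omega, ?_⟩)
      simp only [basisElem, gen, wt, add_zero, Nat.mod_eq_of_lt hb]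
      ring
    · have hb := b.2
      refine Or.inl (Or.inr ⟨i, j, k + 1, b, by omega, by omega, by omega, by omega, by omega, ?_⟩)
      simp only [basisElem, gen, wt, add_zero, Nat.mod_eq_of_lt hb]
      ring
    · refine Or.inr ⟨s + 1, k, b, by omega, by omega, by omega, by omega, ?_⟩
      simp only [basisElem, gen, wt]
      ring
  · rintro ((⟨i, j, b, hi, hj, hb, rfl⟩ | ⟨i, j, k, b, hi, hj, hk1, hk, hb, rfl⟩) |
      ⟨s, k, b, hs1, hs, hk, hb, rfl⟩)
    · refine ⟨(.inl (⟨i, by omega⟩, ⟨j, by omega⟩), ⟨b, by omega⟩), ?_⟩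
      simp only [basisElem, gen, wt, add_zero, Nat.mod_eq_of_lt (show b < q K - 1 by omega)]
      ring
    · obtain ⟨k, rfl⟩ : ∃ k', k = k' + 1 := ⟨k - 1, by omega⟩
      refine ⟨(.inr (.inl (⟨i, by omega⟩, ⟨j, by omega⟩, ⟨k, by omega⟩)), ⟨b, by omega⟩), ?_⟩
      simp only [basisElem, gen, wt, add_zero, Nat.mod_eq_of_lt (show b < q K - 1 by omega)]
      ring
    · obtain ⟨s, rfl⟩ : ∃ s', s = s' + 1 := ⟨s - 1, by omega⟩
      refine ⟨(.inr (.inr (⟨s, by omega⟩, ⟨k, by omega⟩)), ⟨b, by omega⟩), ?_⟩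
      simp only [basisElem, gen, wt]
      ring

variable (K) in
/-- The basis of the invariants of the diagonal `GL₂` over those of `GL₂ × GL₂`. -/
def invBasis : Module.Basis (Idx K × Fin (q K - 1)) (invGLGL K) (invGL K) :=
  Module.Basis.mk (v := fun i => ⟨basisElem i, basisElem_mem_invGL i⟩)
    (by
      rw [Fintype.linearIndependent_iff]
      intro c hc i
      have h1 := congrArg (Subtype.val) hc
      simp only [AddSubmonoidClass.coe_finsetSum, coe_smul_invGL, ZeroMemClass.coe_zero] at h1
      exact Subtype.ext (eq_zero_of_sum_basisElem (fun i => (c i).2) h1 i))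
    (by
      rintro ⟨f, hf⟩ -
      obtain ⟨c, hc⟩ := (Submodule.mem_span_range_iff_exists_fun _).1 (mem_span_basisElem hf)
      refine (Submodule.mem_span_range_iff_exists_fun _).2 ⟨c, Subtype.ext ?_⟩
      simp only [AddSubmonoidClass.coe_finsetSum, coe_smul_invGL]
      exact hc)

theorem coe_invBasis (i : Idx K × Fin (q K - 1)) : (invBasis K i : R K) = basisElem i := by
  simp [invBasis]

theorem basisElem_injective : Function.Injective (basisElem (K := K)) := by
  intro i j hij
  refine (invBasis K).injective (Subtype.ext ?_)
  rw [coe_invBasis, coe_invBasis, hij]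

theorem ncard_D : (D K).ncard = (q K ^ 2 - 1) * (q K ^ 2 - q K) := by
  have hq := two_le_q (K := K)
  rw [← range_basisElem, ← Set.image_univ, Set.ncard_image_of_injective _ basisElem_injective,
    Set.ncard_univ, Nat.card_eq_fintype_card]
  simp only [Fintype.card_prod, Fintype.card_sum, Fintype.card_fin]
  obtain ⟨n, hn⟩ : ∃ n, q K = n + 2 := ⟨q K - 2, by omega⟩
  rw [hn]
  have e1 : (n + 2) ^ 2 - 1 = (n + 1) * (n + 3) := by
    rw [Nat.sub_eq_iff_eq_add (Nat.one_le_pow _ _ (by omega))]; ring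
  have e2 : (n + 2) ^ 2 - (n + 2) = (n + 2) * (n + 1) := by
    rw [Nat.sub_eq_iff_eq_add (Nat.le_self_pow (by omega) _)]; ring
  rw [e1, e2, show n + 2 - 1 = n + 1 by omega, show n + 2 - 2 = n by omega]
  ring

end ModuleBasis

end VectorCovector

/-- Each `h_s` is a genuine polynomial quotient, the set `D` has exactly `(q² - 1)(q² - q)` elements,
and it is a basis of `R₂^{GL₂}` as a module over `R₂^{GL₂ × GL₂}`. -/
theorem theorem4p2 (K : Type*) [Field K] [Fintype K] :
    (∀ s : ℕ, s ≤ Fintype.card K - 1 →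
      VectorCovector.u₀ K ^ Fintype.card K * VectorCovector.h K s = VectorCovector.hNum K s) ∧
    (VectorCovector.D K).ncard =
      (Fintype.card K ^ 2 - 1) * (Fintype.card K ^ 2 - Fintype.card K) ∧
    ∃ b : Module.Basis (VectorCovector.D K) (VectorCovector.invGLGL K) (VectorCovector.invGL K),
      ∀ f : VectorCovector.D K, ((b f : VectorCovector.invGL K) : VectorCovector.R K) = f := by
  have hq : 2 ≤ Fintype.card K := VectorCovector.two_le_q
  refine ⟨fun s hs =>
    VectorCovector.u₀_pow_mul_h K (show s + 1 ≤ Fintype.card K by omega), VectorCovector.ncard_D, ?_⟩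
  let e : VectorCovector.Idx K × Fin (VectorCovector.q K - 1) ≃ VectorCovector.D K :=
    (Equiv.ofInjective _ VectorCovector.basisElem_injective).trans
      (Equiv.setCongr VectorCovector.range_basisElem)
  refine ⟨(VectorCovector.invBasis K).reindex e, fun f => ?_⟩
  obtain ⟨i, rfl⟩ := e.surjective f
  rw [Module.Basis.reindex_apply, e.symm_apply_apply, VectorCovector.coe_invBasis]
  rfl
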